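/- For $x=(x_1,x_2)\in\mathbb{R}^2$ write $x^\perp=(-x_2,x_1)$ and, for $x\ne 0$, $x^*=x/|x|^2$; let $D^c=\{x\in\mathbb{R}^2:|x|>1\}$. Given $\alpha\in\mathbb{R}$ and an initial vorticity $\omega_0$, consider the vorticity form of the incompressible Euler equations in the exterior of the unit disk, $$\partial_t\omega+u\cdot\nabla\omega=0\ \text{ in } D^c\times(0,\infty),\qquad \omega(\cdot,0)=\omega_0\ \text{ in } D^c,$$ $$2\pi u(x,t)=\int_{D^c}\Bigl[\frac{(x-y)^\perp}{|x-y|^2}-\frac{(x-y^*)^\perp}{|x-y^*|^2}\Bigr]\omega(y,t)\,dy+\alpha\frac{x^\perp}{|x|^2}.$$ A classical solution is a function $\omega$ that is $C^1$ on $D^c\times[0,\infty)$, is bounded in $L^1(D^c)\cap L^\infty(D^c)$ uniformly on every bounded time interval $[0,T]$, and satisfies these equations. **Theorem.** Let $\omega_0\in C^1_c(D^c)$ be nonnegative and even, $\omega_0(-x)=\omega_0(x)$ for all $x$. Then there exists a constant $M>0$, depending only on $\omega_0$, such that for every $\alpha\in\mathbb{R}$ and every classical solution $\omega$ with initial vorticity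 $\omega_0$, $$\operatorname{supp}\omega(\cdot,t)\subset\bigl\{x:\ |x|\le M\,[(1+t)\log(2+t)]^{1/4}\bigr\}\qquad\text{for all } t\ge 0.$$ -/

import Mathlib

open MeasureTheory Set

noncomputable section

/-- The Euclidean plane. -/
abbrev Plane : Type := EuclideanSpace ℝ (Fin 2)

/-- The open exterior `{|x| > 1}` of the closed unit disk. -/
def exteriorDisk : Set Plane := {x | 1 < ‖x‖}

/-- Rotation by a right angle, `x^⊥ = (-x₂, x₁)`. -/
def perp (x : Plane) : Plane := !₂[-(x 1), x 0]

/-- Inversion in the unit circle, `x^* = x / |x|²`. -/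
def inversionPt (x : Plane) : Plane := (‖x‖ ^ 2)⁻¹ • x

/-- The kernel `(x-y)^⊥ / |x-y|² - (x-y^*)^⊥ / |x-y^*|²`, which is `2π` times the perpendicular
gradient in `x` of the Green's function of the exterior of the unit disk. -/
def biotSavartKernel (x y : Plane) : Plane :=
  (‖x - y‖ ^ 2)⁻¹ • perp (x - y) - (‖x - inversionPt y‖ ^ 2)⁻¹ • perp (x - inversionPt y)

/-- The velocity field `u` determined by the vorticity `w` and the coefficient `α` of the harmonic
part of the flow:
`2π u(x) = ∫_{|y|>1} [(x-y)^⊥/|x-y|² - (x-y^*)^⊥/|x-y^*|²] w(y) dy + α x^⊥/|x|²`. -/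
def velocity (α : ℝ) (w : Plane → ℝ) (x : Plane) : Plane :=
  (2 * Real.pi)⁻¹ •
    ((∫ y in exteriorDisk, w y • biotSavartKernel x y) + (α * (‖x‖ ^ 2)⁻¹) • perp x)

/-- `ω` (time first, then space) is a classical solution on `[0, ∞)` of the vorticity form of the
incompressible Euler equations in the exterior of the unit disk, with harmonic coefficient `α` and
initial vorticity `ω₀`. Only the values `ω t x` with `0 ≤ t` and `1 < |x|` matter. -/
structure IsExteriorEulerSolution (α : ℝ) (ω₀ : Plane → ℝ) (ω : ℝ → Plane → ℝ) : Prop where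
  /-- The vorticity is continuously differentiable in time and space, up to time `0`. -/
  contDiffOn : ContDiffOn ℝ 1 (fun p : ℝ × Plane => ω p.1 p.2) (Ici 0 ×ˢ exteriorDisk)
  /-- On bounded time intervals the vorticity is bounded in `L¹ ∩ L^∞`, so that the
  integral defining the velocity converges absolutely at every point. -/
  bounded : ∀ T : ℝ, ∃ C : ℝ, ∀ t ∈ Icc 0 T,
    (∀ x ∈ exteriorDisk, |ω t x| ≤ C) ∧
      IntegrableOn (ω t) exteriorDisk ∧ ∫ x in exteriorDisk, |ω t x| ≤ C
  /-- The transport equation `∂ₜω + u · ∇ω = 0`. -/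
  transport : ∀ t : ℝ, 0 < t → ∀ x ∈ exteriorDisk,
    deriv (fun s => ω s x) t + fderiv ℝ (ω t) x (velocity α (ω t) x) = 0
  /-- The initial condition. -/
  initial : ∀ x ∈ exteriorDisk, ω 0 x = ω₀ x

/-- The support of a vorticity `w` on the exterior of the unit disk. -/
def vorticitySupport (w : Plane → ℝ) : Set Plane := closure {x | x ∈ exteriorDisk ∧ w x ≠ 0}

end

/-! The radial velocity satisfies $2\pi\,x\cdot u(x)=\int K(x,y)\,\omega(y)\,dy$ with $K$ =
`radialKernel`. The harmonic part $\alpha x^\perp/|x|^2$ is tangential and drops out, which is why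
$M$ does not depend on $\alpha$. Since $|y|^2|x-y^*|^2=|x-y|^2+(|x|^2-1)(|y|^2-1)$ is symmetric, $K$
is antisymmetric (`radialKernel_swap`), and so the moment of inertia $I=\int|x|^2\omega$ is
conserved.

Evenness of $\omega$ persists (`IsExtendedSolution.even`), so $K(x,y)$ may be averaged with
$K(x,-y)$. The leading terms cancel: the sum is at most $8|y|^2/|x|^2$ for $2|y|\le|x|$
(`abs_radialKernel_add_neg_le`). Vorticity in $2|y|\le|x|$ therefore contributes $O(I/|x|^2)$ to
$x\cdot u$.

For the remaining vorticity, symmetrizing the derivative of the moments $\int|x|^{4n}\omega$ gives a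
recursion in $n$ whose solution is $m(\rho+8Int)^n$, with $m=\int\omega_0$ and $\rho$ a bound for
$|x|^4$ on the initial support (`IsExtendedSolution.moment_le`). With $n\sim4\log(2+t)$ and
$|x|^4\ge K_0(1+t)\log(2+t)$ for a constant $K_0$, the mass beyond $|x|/2$ is $O(|x|^{-6})$
(`moment_ratio_le`). A bounded density of mass $r^2$ induces velocity $O(r)$, so this part also
contributes $O(|x|^{-2})$ to $x\cdot u$ (`IsEvenDatum.exists_radial_decay`). Hence $|x|^4$ has
bounded material derivative beyond that radius, and the vorticity cannot cross the faster barrier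
$|x|^4=\mu(1+t)\log(2+t)$ with $\mu$ large (`IsEvenDatum.exists_confinement`).

No particle trajectories are used. Transport enters through
$\frac{d}{dt}\int\beta(\omega)\varphi=\int\beta(\omega)(\partial_t\varphi+u\cdot\nabla\varphi)$
(`IsExtendedSolution.hasDerivAt_integral`), which rests on $u$ being weakly divergence free, and
barriers enter through `IsExtendedSolution.eq_zero_of_barrier`. Compact support at later times is
not assumed: it follows from a log-Lipschitz bound on the radial velocity at the circle and its at
most linear growth at infinity (`IsExtendedSolution.exists_closedAnnulus`). -/

/-! ### Algebra of the plane. -/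

lemma plane_norm_sq (x : Plane) : ‖x‖ ^ 2 = x 0 ^ 2 + x 1 ^ 2 := by
  simp [EuclideanSpace.norm_sq_eq, Fin.sum_univ_two]

lemma plane_inner (x y : Plane) : inner ℝ x y = x 0 * y 0 + x 1 * y 1 := by
  simp [PiLp.inner_apply, Fin.sum_univ_two, mul_comm]

@[simp] lemma perp_apply_zero (x : Plane) : perp x 0 = -(x 1) := by simp [perp]
@[simp] lemma perp_apply_one (x : Plane) : perp x 1 = x 0 := by simp [perp]

lemma perp_add (x y : Plane) : perp (x + y) = perp x + perp y := by
  ext i; fin_cases i <;> simp [add_comm]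

lemma perp_smul (c : ℝ) (x : Plane) : perp (c • x) = c • perp x := by
  ext i; fin_cases i <;> simp

lemma perp_neg (x : Plane) : perp (-x) = -perp x := by
  ext i; fin_cases i <;> simp

@[simp] lemma perp_zero : perp 0 = 0 := by
  ext i; fin_cases i <;> simp

lemma norm_perp (x : Plane) : ‖perp x‖ = ‖x‖ := by
  have h : ‖perp x‖ ^ 2 = ‖x‖ ^ 2 := by
    rw [plane_norm_sq, plane_norm_sq]; simp; ring
  exact (pow_left_inj₀ (norm_nonneg _) (norm_nonneg _) two_ne_zero).1 h

/-- Rotation by a right angle as a continuous linear map. -/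
noncomputable def perpL : Plane →L[ℝ] Plane :=
  LinearMap.toContinuousLinearMap
    { toFun := perp, map_add' := perp_add, map_smul' := perp_smul }

@[simp] lemma perpL_apply (x : Plane) : perpL x = perp x := rfl

@[fun_prop] lemma continuous_perp : Continuous perp := perpL.continuous

@[fun_prop] lemma measurable_perp : Measurable perp := continuous_perp.measurable

lemma perp_perp (x : Plane) : perp (perp x) = -x := by
  ext i; fin_cases i <;> simp

/-- The scalar product `x · y^⊥`. -/
def cross (x y : Plane) : ℝ := x 1 * y 0 - x 0 * y 1

lemma cross_swap (x y : Plane) : cross y x = -cross x y := by simp only [cross]; ring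

lemma cross_neg_right (x y : Plane) : cross x (-y) = -cross x y := by simp [cross]; ring

lemma cross_sq_add_inner_sq (x y : Plane) :
    cross x y ^ 2 + inner ℝ x y ^ 2 = ‖x‖ ^ 2 * ‖y‖ ^ 2 := by
  rw [plane_norm_sq, plane_norm_sq, plane_inner, cross]; ring

lemma abs_cross_le (x y : Plane) : |cross x y| ≤ ‖x‖ * ‖y‖ := by
  apply abs_le_of_sq_le_sq _ (by positivity)
  rw [mul_pow, ← cross_sq_add_inner_sq]
  nlinarith [sq_nonneg (inner ℝ x y : ℝ)]

lemma abs_cross_le_left (x y : Plane) : |cross x y| ≤ ‖x‖ * ‖x - y‖ := by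
  have : cross x y = -cross x (x - y) := by simp [cross]; ring
  rw [this, abs_neg]; exact abs_cross_le _ _

lemma cross_same (x : Plane) : cross x x = 0 := by simp [cross]; ring

/-! ### Pointwise estimates for the radial kernel. -/

/-- The radial component `x · K(x, y)` of the Biot–Savart kernel of the exterior domain. -/
noncomputable def radialKernel (x y : Plane) : ℝ := inner ℝ x (biotSavartKernel x y)

lemma inner_perp_sub (x y : Plane) : inner ℝ x (perp (x - y)) = -cross x y := by
  rw [plane_inner]; simp [cross]; ring

/-- The identity $|y|^2|x-y^*|^2=|x-y|^2+(|x|^2-1)(|y|^2-1)$ puts the image vortex in symmetric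
form: `cross` is antisymmetric and the bracket symmetric, which yields `radialKernel_swap`. -/
lemma radialKernel_eq {x y : Plane} (hy : 1 < ‖y‖) :
    radialKernel x y = cross x y *
      ((‖x - y‖ ^ 2 + (‖x‖ ^ 2 - 1) * (‖y‖ ^ 2 - 1))⁻¹ - (‖x - y‖ ^ 2)⁻¹) := by
  have hy0 : ‖y‖ ^ 2 ≠ 0 := by positivity
  have h1 : cross x (inversionPt y) = (‖y‖ ^ 2)⁻¹ * cross x y := by
    simp [cross, inversionPt]; ring
  have h2 : ‖x - y‖ ^ 2 + (‖x‖ ^ 2 - 1) * (‖y‖ ^ 2 - 1)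
      = ‖y‖ ^ 2 * ‖x - inversionPt y‖ ^ 2 := by
    have h3 : ‖x - inversionPt y‖ ^ 2 =
        ‖x‖ ^ 2 - 2 * ((‖y‖ ^ 2)⁻¹ * inner ℝ x y) + (‖y‖ ^ 2)⁻¹ := by
      rw [norm_sub_sq_real, inversionPt, inner_smul_right, norm_smul, mul_pow]
      simp only [norm_inv, norm_pow, norm_norm]
      field_simp
    rw [h3, norm_sub_sq_real]
    field_simp
    ring
  rw [radialKernel, biotSavartKernel, inner_sub_right, inner_smul_right, inner_smul_right,
    inner_perp_sub, inner_perp_sub, h1, h2, mul_inv]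
  ring

lemma exterior_product_pos {x y : Plane} (hx : 1 < ‖x‖) (hy : 1 < ‖y‖) :
    0 < (‖x‖ ^ 2 - 1) * (‖y‖ ^ 2 - 1) :=
  mul_pos (by nlinarith) (by nlinarith)

lemma radialKernel_swap {x y : Plane} (hx : 1 < ‖x‖) (hy : 1 < ‖y‖) :
    radialKernel y x = -radialKernel x y := by
  rw [radialKernel_eq hy, radialKernel_eq hx, cross_swap, norm_sub_rev y x]; ring

lemma radialKernel_neg_neg {x y : Plane} (hy : 1 < ‖y‖) :
    radialKernel (-x) (-y) = radialKernel x y := by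
  rw [radialKernel_eq hy, radialKernel_eq (by simpa using hy)]
  have : ‖-x - -y‖ = ‖x - y‖ := by rw [← norm_neg]; congr 1; abel
  simp only [this, norm_neg]
  congr 1
  simp [cross]

lemma abs_radialKernel {x y : Plane} (hx : 1 < ‖x‖) (hy : 1 < ‖y‖) :
    |radialKernel x y| = |cross x y| * (((‖x‖ ^ 2 - 1) * (‖y‖ ^ 2 - 1)) /
      (‖x - y‖ ^ 2 * (‖x - y‖ ^ 2 + (‖x‖ ^ 2 - 1) * (‖y‖ ^ 2 - 1)))) := by
  have hP := exterior_product_pos hx hy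
  rcases eq_or_ne x y with rfl | hxy
  · rw [radialKernel_eq hy, cross_same]; simp
  have hd : 0 < ‖x - y‖ := norm_pos_iff.2 (sub_ne_zero.2 hxy)
  rw [radialKernel_eq hy, abs_mul]
  congr 1
  rw [abs_of_nonpos]
  · field_simp; ring
  · rw [sub_nonpos]
    gcongr
    linarith

lemma abs_radialKernel_le_cross {x y : Plane} (hx : 1 < ‖x‖) (hy : 1 < ‖y‖) :
    |radialKernel x y| ≤ |cross x y| / ‖x - y‖ ^ 2 := by
  have hP := exterior_product_pos hx hy
  rw [abs_radialKernel hx hy, div_eq_mul_inv |cross x y|]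
  rcases eq_or_ne x y with rfl | hxy
  · simp
  have hd : 0 < ‖x - y‖ := norm_pos_iff.2 (sub_ne_zero.2 hxy)
  refine mul_le_mul_of_nonneg_left ?_ (abs_nonneg _)
  rw [div_le_iff₀ (by positivity)]
  field_simp
  nlinarith [sq_nonneg (‖x - y‖)]

lemma abs_radialKernel_le_left {x y : Plane} (hx : 1 < ‖x‖) (hy : 1 < ‖y‖) :
    |radialKernel x y| ≤ ‖x‖ * ‖x - y‖⁻¹ := by
  refine (abs_radialKernel_le_cross hx hy).trans ?_
  rcases eq_or_ne x y with rfl | hxy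
  · simp
  have hd : 0 < ‖x - y‖ := norm_pos_iff.2 (sub_ne_zero.2 hxy)
  rw [div_le_iff₀ (by positivity)]
  refine (abs_cross_le_left x y).trans (le_of_eq ?_)
  field_simp

lemma abs_radialKernel_le_right {x y : Plane} (hx : 1 < ‖x‖) (hy : 1 < ‖y‖) :
    |radialKernel x y| ≤ ‖y‖ * ‖x - y‖⁻¹ := by
  have := abs_radialKernel_le_left hy hx
  rwa [radialKernel_swap hx hy, abs_neg, norm_sub_rev] at this

lemma norm_inv_sq_smul_perp (x : Plane) : ‖(‖x‖ ^ 2)⁻¹ • perp x‖ = ‖x‖⁻¹ := by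
  rw [norm_smul, norm_perp]
  rcases eq_or_ne ‖x‖ 0 with h | h
  · simp [h]
  · simp; field_simp

lemma norm_inversionPt_le {y : Plane} (hy : 1 < ‖y‖) : ‖inversionPt y‖ ≤ 1 := by
  rw [inversionPt, norm_smul]
  simp only [norm_inv, norm_pow, norm_norm]
  rw [inv_mul_le_iff₀ (by positivity)]
  nlinarith

lemma norm_biotSavartKernel_le {x y : Plane} (hx : 1 < ‖x‖) (hy : 1 < ‖y‖) :
    ‖biotSavartKernel x y‖ ≤ ‖x - y‖⁻¹ + (‖x‖ - 1)⁻¹ := by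
  refine (norm_sub_le _ _).trans ?_
  rw [norm_inv_sq_smul_perp, norm_inv_sq_smul_perp]
  have : ‖x‖ - 1 ≤ ‖x - inversionPt y‖ := by
    have := norm_sub_norm_le x (inversionPt y)
    linarith [norm_inversionPt_le hy]
  gcongr

/-- Each kernel alone is only $O(|y|/|x|)$. As `cross` is odd in $y$, the sum is a difference of the
brackets at $y$ and $-y$, which gains another factor $|y|/|x|$. -/
lemma abs_radialKernel_add_neg_le {x y : Plane} (hy : 1 < ‖y‖) (hxy : 2 * ‖y‖ ≤ ‖x‖) :
    |radialKernel x y + radialKernel x (-y)| ≤ 8 * ‖y‖ ^ 2 / ‖x‖ ^ 2 := by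
  have hx : 2 < ‖x‖ := by linarith
  rw [radialKernel_eq hy, radialKernel_eq (x := x) (y := -y) (by simpa using hy), cross_neg_right,
    norm_sub_sq_real, norm_sub_sq_real, norm_neg, inner_neg_right]
  have hc := abs_cross_le x y
  have hp : |inner ℝ x y| ≤ ‖x‖ * ‖y‖ := abs_real_inner_le_norm x y
  set a := ‖x‖
  set b := ‖y‖
  set c := cross x y
  set p : ℝ := inner ℝ x y
  have hp2 : p ^ 2 ≤ a ^ 2 * b ^ 2 := by
    rw [← mul_pow]; exact sq_le_sq' (by linarith [(abs_le.1 hp).1]) (abs_le.1 hp).2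
  have hP : 0 < (a ^ 2 - 1) * (b ^ 2 - 1) := mul_pos (by nlinarith) (by nlinarith)
  set P := (a ^ 2 - 1) * (b ^ 2 - 1)
  have hE1 : 0 < a ^ 2 + b ^ 2 - 2 * p := by nlinarith [(abs_le.1 hp).2]
  have hE2 : 0 < a ^ 2 + b ^ 2 + 2 * p := by nlinarith [(abs_le.1 hp).1]
  -- This is $|x-y|^2|x+y|^2\ge(|x|^2-|y|^2)^2$ together with $|y|\le|x|/2$. It leads to the
  -- constant $4\cdot16/9\le8$.
  have hEE : 9 / 16 * a ^ 4 ≤ (a ^ 2 + b ^ 2 - 2 * p) * (a ^ 2 + b ^ 2 + 2 * p) := by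
    have h1 : (a ^ 2 - b ^ 2) ^ 2 ≤ (a ^ 2 + b ^ 2 - 2 * p) * (a ^ 2 + b ^ 2 + 2 * p) := by
      nlinarith
    have h2 : 3 / 4 * a ^ 2 ≤ a ^ 2 - b ^ 2 := by nlinarith
    nlinarith [sq_nonneg a]
  set E := a ^ 2 + b ^ 2 with hE
  have key : c * ((a ^ 2 - 2 * p + b ^ 2 + P)⁻¹ - (a ^ 2 - 2 * p + b ^ 2)⁻¹) +
      -c * ((a ^ 2 - 2 * -p + b ^ 2 + P)⁻¹ - (a ^ 2 - 2 * -p + b ^ 2)⁻¹) =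
      4 * c * p * (((E - 2 * p + P) * (E + 2 * p + P))⁻¹ - ((E - 2 * p) * (E + 2 * p))⁻¹) := by
    rw [show a ^ 2 - 2 * p + b ^ 2 = E - 2 * p by rw [hE]; ring,
      show a ^ 2 - 2 * -p + b ^ 2 = E + 2 * p by rw [hE]; ring]
    have h3 : E - 2 * p + P ≠ 0 := by positivity
    have h4 : E + 2 * p + P ≠ 0 := by positivity
    field_simp
    ring
  rw [key, abs_mul]
  have h5 : |((E - 2 * p + P) * (E + 2 * p + P))⁻¹ - ((E - 2 * p) * (E + 2 * p))⁻¹| ≤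
      ((E - 2 * p) * (E + 2 * p))⁻¹ := by
    have h6 : 0 < ((E - 2 * p + P) * (E + 2 * p + P))⁻¹ := by positivity
    have h7 : ((E - 2 * p + P) * (E + 2 * p + P))⁻¹ ≤ ((E - 2 * p) * (E + 2 * p))⁻¹ := by
      apply inv_anti₀ (by positivity)
      apply mul_le_mul <;> linarith
    rw [abs_le]; constructor <;> linarith
  have h8 : |4 * c * p| ≤ 4 * (a * b) ^ 2 := by
    rw [abs_mul, abs_mul, sq, abs_of_pos (by norm_num : (0:ℝ) < 4), mul_assoc]
    gcongr
  have h9 : ((E - 2 * p) * (E + 2 * p))⁻¹ ≤ (9 / 16 * a ^ 4)⁻¹ := by gcongr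
  calc _ ≤ 4 * (a * b) ^ 2 * (9 / 16 * a ^ 4)⁻¹ := by gcongr; exact h5.trans h9
    _ ≤ _ := by
      have ha : 0 < a := by linarith
      rw [le_div_iff₀ (by positivity)]
      field_simp
      norm_num

lemma abs_sub_pow_le {a b : ℝ} (hb : 0 ≤ b) (hab : b ≤ a) (q : ℕ) :
    |a ^ (q + 1) - b ^ (q + 1)| ≤ (q + 1) * |a - b| * a ^ q := by
  rw [abs_of_nonneg (sub_nonneg.2 (by gcongr)), abs_of_nonneg (sub_nonneg.2 hab)]
  induction q with
  | zero => simp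
  | succ q ih =>
    have h1 : b ^ (q + 1) ≤ a ^ (q + 1) := by gcongr
    have h2 : a ^ (q + 1 + 1) - b ^ (q + 1 + 1)
      = a * (a ^ (q + 1) - b ^ (q + 1)) + (a - b) * b ^ (q + 1) := by ring
    rw [h2]
    have ha : 0 ≤ a := hb.trans hab
    push_cast
    calc _ ≤ a * ((q + 1) * (a - b) * a ^ q) + (a - b) * a ^ (q + 1) := by
            gcongr
      _ = _ := by ring

lemma abs_norm_sq_sub_norm_sq_le (x y : Plane) :
    |‖x‖ ^ 2 - ‖y‖ ^ 2| ≤ ‖x - y‖ * (‖x‖ + ‖y‖) := by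
  rw [sq_sub_sq, abs_mul, mul_comm, abs_of_nonneg (by positivity : 0 ≤ ‖x‖ + ‖y‖)]
  gcongr
  exact abs_norm_sub_norm_le x y

lemma norm_sq_sub_mul_radialKernel_le {x y : Plane} (hy : 1 < ‖y‖) (hxy : ‖y‖ ≤ ‖x‖) :
    |‖x‖ ^ 2 - ‖y‖ ^ 2| * |radialKernel x y| ≤ 2 * ‖x‖ * ‖y‖ := by
  have h1 := abs_norm_sq_sub_norm_sq_le x y
  have h2 := abs_radialKernel_le_right (hy.trans_le hxy) hy
  calc _ ≤ (‖x - y‖ * (‖x‖ + ‖y‖)) * (‖y‖ * ‖x - y‖⁻¹) := by gcongr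
    _ = (‖x - y‖ * ‖x - y‖⁻¹) * ((‖x‖ + ‖y‖) * ‖y‖) := by ring
    _ ≤ 1 * ((‖x‖ + ‖x‖) * ‖y‖) := by
      gcongr
      exact mul_inv_le_one
    _ = _ := by ring

/-- Two regimes: for $2|y|\le|x|$ the cancellation between $y$ and $-y$ suffices; for comparable
norms the factor $|x|^2-|y|^2$, small both near $y=x$ and near $y=-x$, absorbs the singularity of
the kernels. -/
lemma moment_kernel_le_of_norm_le {x y : Plane} (hy : 1 < ‖y‖) (hxy : ‖y‖ ≤ ‖x‖) (q : ℕ) :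
    |((‖x‖ ^ 2) ^ (q + 1) - (‖y‖ ^ 2) ^ (q + 1)) * (radialKernel x y + radialKernel x (-y))| ≤
      8 * (q + 1) * ((‖x‖ ^ 2) ^ q * ‖y‖ ^ 2) := by
  rw [abs_mul]
  have hx : 1 < ‖x‖ := hy.trans_le hxy
  rcases le_total (2 * ‖y‖) ‖x‖ with h | h
  · have h1 := abs_radialKernel_add_neg_le hy h
    have h2 : |(‖x‖ ^ 2) ^ (q + 1) - (‖y‖ ^ 2) ^ (q + 1)| ≤ (‖x‖ ^ 2) ^ (q + 1) := by
      rw [abs_of_nonneg (sub_nonneg.2 (by gcongr))]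
      linarith [show 0 ≤ (‖y‖ ^ 2) ^ (q + 1) by positivity]
    calc _ ≤ (‖x‖ ^ 2) ^ (q + 1) * (8 * ‖y‖ ^ 2 / ‖x‖ ^ 2) := by gcongr
      _ = 8 * 1 * ((‖x‖ ^ 2) ^ q * ‖y‖ ^ 2) := by
        field_simp
        ring
      _ ≤ _ := by gcongr; linarith [(Nat.cast_nonneg q : (0 : ℝ) ≤ q)]
  · have h1 := norm_sq_sub_mul_radialKernel_le hy hxy
    have h2 := norm_sq_sub_mul_radialKernel_le (x := x) (y := -y) (by simpa) (by simpa)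
    rw [norm_neg] at h2
    have h3 := abs_sub_pow_le (a := ‖x‖ ^ 2) (b := ‖y‖ ^ 2) (by positivity) (by gcongr) q
    calc _ ≤ ((q + 1) * |‖x‖ ^ 2 - ‖y‖ ^ 2| * (‖x‖ ^ 2) ^ q) *
          (|radialKernel x y| + |radialKernel x (-y)|) := by
            gcongr
            exact abs_add_le _ _
      _ = (q + 1) * (‖x‖ ^ 2) ^ q * (|‖x‖ ^ 2 - ‖y‖ ^ 2| * |radialKernel x y| +
            |‖x‖ ^ 2 - ‖y‖ ^ 2| * |radialKernel x (-y)|) := by ring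
      _ ≤ (q + 1) * (‖x‖ ^ 2) ^ q * (2 * ‖x‖ * ‖y‖ + 2 * ‖x‖ * ‖y‖) := by gcongr
      _ ≤ (q + 1) * (‖x‖ ^ 2) ^ q * (2 * (2 * ‖y‖) * ‖y‖ + 2 * (2 * ‖y‖) * ‖y‖) := by gcongr
      _ = _ := by ring

lemma moment_kernel_le {x y : Plane} (hx : 1 < ‖x‖) (hy : 1 < ‖y‖) (q : ℕ) :
    |((‖x‖ ^ 2) ^ (q + 1) - (‖y‖ ^ 2) ^ (q + 1)) * (radialKernel x y + radialKernel x (-y))| ≤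
      8 * (q + 1) * ((‖x‖ ^ 2) ^ q * ‖y‖ ^ 2 + (‖y‖ ^ 2) ^ q * ‖x‖ ^ 2) := by
  rw [mul_add (8 * ((q : ℝ) + 1))]
  rcases le_total ‖y‖ ‖x‖ with h | h
  · refine (moment_kernel_le_of_norm_le hy h q).trans ?_
    rw [le_add_iff_nonneg_right]; positivity
  · have h1 := moment_kernel_le_of_norm_le hx h q
    have h2 : radialKernel y (-x) = -radialKernel x (-y) := by
      rw [← radialKernel_neg_neg (x := x) (y := -y) (by simpa), neg_neg,
        ← radialKernel_swap (by simpa) hy]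
    rw [radialKernel_swap hx hy, h2] at h1
    rw [show ((‖x‖ ^ 2) ^ (q + 1) - (‖y‖ ^ 2) ^ (q + 1)) * (radialKernel x y + radialKernel x (-y))
      = ((‖y‖ ^ 2) ^ (q + 1) - (‖x‖ ^ 2) ^ (q + 1)) *
        (-radialKernel x y + -radialKernel x (-y)) by ring]
    refine h1.trans ?_
    rw [le_add_iff_nonneg_left]; positivity

/-! ### Potential estimates for bounded integrable vorticities. -/

/-- A vorticity vanishing off the exterior domain, with `L¹` norm at most `A` and
`L^∞` norm at most `B`. -/
structure IsBoundedVorticity (w : Plane → ℝ) (A B : ℝ) : Prop where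
  eq_zero : ∀ x, x ∉ exteriorDisk → w x = 0
  integrable : Integrable w
  integral_abs_le : ∫ x, |w x| ≤ A
  abs_le : ∀ x, |w x| ≤ B

lemma IsBoundedVorticity.nonneg_left {w : Plane → ℝ} {A B : ℝ} (h : IsBoundedVorticity w A B) :
    0 ≤ A := (integral_nonneg fun _ => abs_nonneg _).trans h.integral_abs_le

lemma IsBoundedVorticity.nonneg_right {w : Plane → ℝ} {A B : ℝ} (h : IsBoundedVorticity w A B) :
    0 ≤ B := (abs_nonneg _).trans (h.abs_le 0)

lemma plane_integral_norm (f : ℝ → ℝ) :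
    ∫ x : Plane, f ‖x‖ = 2 * Real.pi * ∫ y in Ioi (0 : ℝ), y * f y := by
  rw [integral_fun_norm_addHaar (volume : Measure Plane) f]
  have h : (volume : Measure Plane).real (Metric.ball 0 1) = Real.pi := by
    simp [Measure.real, ENNReal.toReal_ofReal Real.pi_pos.le]
  simp [h]
  ring

lemma plane_integrable_norm {f : ℝ → ℝ} :
    Integrable (fun x : Plane => f ‖x‖) ↔ IntegrableOn (fun y : ℝ => y * f y) (Ioi 0) := by
  rw [integrable_fun_norm_addHaar (volume : Measure Plane)]
  simp

/-- The kernel `1/|z|` cut off to the disk of radius `r`. -/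
noncomputable def nearKernel (r : ℝ) (z : Plane) : ℝ := (Iio r).indicator (fun t => t⁻¹) ‖z‖

/-- The kernel `1/|z|²` cut off to the annulus `ε ≤ |z| < 1`. -/
noncomputable def annulusKernel (ε : ℝ) (z : Plane) : ℝ :=
  (Ico ε 1).indicator (fun t => (t ^ 2)⁻¹) ‖z‖

lemma nearKernel_nonneg (r : ℝ) (z : Plane) : 0 ≤ nearKernel r z := by
  unfold nearKernel; exact indicator_apply_nonneg fun _ => by positivity

lemma annulusKernel_nonneg (ε : ℝ) (z : Plane) : 0 ≤ annulusKernel ε z := by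
  unfold annulusKernel; exact indicator_apply_nonneg fun _ => by positivity

lemma near_radial_eq (r : ℝ) : EqOn (fun y : ℝ => y * (Iio r).indicator (fun t => t⁻¹) y)
    ((Ioo 0 r).indicator fun _ => 1) (Ioi 0) := by
  intro y (hy : 0 < y)
  by_cases h : y < r <;> simp [h, hy, hy.ne']

lemma integrable_nearKernel (r : ℝ) : Integrable (nearKernel r) := by
  unfold nearKernel
  rw [plane_integrable_norm, integrableOn_congr_fun (near_radial_eq r) measurableSet_Ioi]
  apply Integrable.integrableOn
  rw [integrable_indicator_iff measurableSet_Ioo]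
  exact integrableOn_const (by simp)

lemma integral_nearKernel {r : ℝ} (hr : 0 ≤ r) : ∫ z, nearKernel r z = 2 * Real.pi * r := by
  unfold nearKernel
  rw [plane_integral_norm, setIntegral_congr_fun measurableSet_Ioi (near_radial_eq r),
    setIntegral_indicator measurableSet_Ioo]
  have : Ioi 0 ∩ Ioo 0 r = Ioo 0 r := by ext; simp
  rw [this]
  simp [hr]

lemma annulus_radial_eq (ε : ℝ) :
    EqOn (fun y : ℝ => y * (Ico ε 1).indicator (fun t => (t ^ 2)⁻¹) y)
    ((Ico ε 1).indicator fun t => t⁻¹) (Ioi 0) := by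
  intro y (hy : 0 < y)
  by_cases h : y ∈ Ico ε 1
  · simp [h]; field_simp
  · simp [h]

lemma integrable_annulusKernel {ε : ℝ} (hε : 0 < ε) : Integrable (annulusKernel ε) := by
  unfold annulusKernel
  rw [plane_integrable_norm, integrableOn_congr_fun (annulus_radial_eq ε) measurableSet_Ioi]
  apply Integrable.integrableOn
  rw [integrable_indicator_iff measurableSet_Ico]
  refine IntegrableOn.mono_set (t := Icc ε 1) ?_ Ico_subset_Icc_self
  apply ContinuousOn.integrableOn_Icc
  apply ContinuousOn.inv₀ continuousOn_id
  intro x hx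
  exact (hε.trans_le hx.1).ne'

lemma integral_annulusKernel {ε : ℝ} (hε : 0 < ε) (h1 : ε ≤ 1) :
    ∫ z, annulusKernel ε z = 2 * Real.pi * (-Real.log ε) := by
  unfold annulusKernel
  rw [plane_integral_norm, setIntegral_congr_fun measurableSet_Ioi (annulus_radial_eq ε),
    setIntegral_indicator measurableSet_Ico]
  have : Ioi 0 ∩ Ico ε 1 = Ico ε 1 := by
    ext y; simp only [mem_inter_iff, mem_Ioi, mem_Ico, and_iff_right_iff_imp]
    intro h; linarith
  rw [this, integral_Ico_eq_integral_Ioc, ← intervalIntegral.integral_of_le h1,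
    integral_inv_of_pos hε one_pos]
  simp

lemma inv_norm_le_nearKernel {r : ℝ} (hr : 0 < r) (z : Plane) :
    ‖z‖⁻¹ ≤ nearKernel r z + r⁻¹ := by
  unfold nearKernel
  by_cases h : ‖z‖ < r
  · simp [h]; positivity
  · simp only [mem_Iio, h, not_false_eq_true, indicator_of_notMem, zero_add]
    gcongr
    linarith

lemma abs_integral_le_of_abs_le {X : Type*} [MeasurableSpace X] {μ : Measure X} {f g : X → ℝ}
    (hg : Integrable g μ) (h : ∀ x, |f x| ≤ g x) : |∫ x, f x ∂μ| ≤ ∫ x, g x ∂μ := by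
  rw [← Real.norm_eq_abs]
  exact norm_integral_le_of_norm_le hg (Filter.Eventually.of_forall h)

lemma integrable_kernel_mul {k w : Plane → ℝ} (hk : Integrable k) {B : ℝ}
    (hw : AEStronglyMeasurable w) (hB : ∀ x, |w x| ≤ B) (x : Plane) :
    Integrable fun y => k (x - y) * w y :=
  (hk.comp_sub_left x).mul_bdd hw (Filter.Eventually.of_forall hB)

lemma integral_kernel_mul_abs_le {k w : Plane → ℝ} (hk : Integrable k) (hk0 : ∀ z, 0 ≤ k z) {B : ℝ}
    (hB : ∀ x, |w x| ≤ B) (x : Plane) :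
    ∫ y, k (x - y) * |w y| ≤ (∫ z, k z) * B := by
  calc _ ≤ ∫ y, k (x - y) * B := by
        apply integral_mono_of_nonneg
        · exact Filter.Eventually.of_forall fun y => mul_nonneg (hk0 _) (abs_nonneg _)
        · exact (hk.comp_sub_left x).mul_const B
        · exact Filter.Eventually.of_forall fun y =>
            mul_le_mul_of_nonneg_left (hB y) (hk0 _)
    _ = _ := by rw [integral_mul_const, integral_sub_left_eq_self k volume x]

section
variable {w : Plane → ℝ} {A B : ℝ}

lemma IsBoundedVorticity.abs (h : IsBoundedVorticity w A B) :
    IsBoundedVorticity (fun x => |w x|) A B :=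
  ⟨fun x hx => by simp [h.eq_zero x hx], h.integrable.abs, by simpa using h.integral_abs_le,
    by simpa using h.abs_le⟩

lemma IsBoundedVorticity.integrable_inv_norm_mul (h : IsBoundedVorticity w A B) (x : Plane) :
    Integrable fun y => ‖x - y‖⁻¹ * |w y| := by
  have h1 : Integrable fun y => nearKernel 1 (x - y) * |w y| + 1⁻¹ * |w y| :=
    (integrable_kernel_mul (integrable_nearKernel 1) h.abs.integrable.aestronglyMeasurable
      h.abs.abs_le x).add (h.integrable.abs.const_mul _)
  refine h1.mono' ?_ (Filter.Eventually.of_forall fun y => ?_)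
  · exact (by fun_prop : Measurable fun y => ‖x - y‖⁻¹).aestronglyMeasurable.mul
      h.abs.integrable.aestronglyMeasurable
  · rw [Real.norm_of_nonneg (by positivity), ← add_mul]
    gcongr
    exact inv_norm_le_nearKernel one_pos _

/-- The kernel is split at distance $r$. Leaving $r$ free allows $r^2\ge A$ later, which makes the
bound linear in $r$. -/
lemma IsBoundedVorticity.integral_inv_norm_mul_le (h : IsBoundedVorticity w A B) (x : Plane)
    {r : ℝ} (hr : 0 < r) :
    ∫ y, ‖x - y‖⁻¹ * |w y| ≤ 2 * Real.pi * r * B + r⁻¹ * A := by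
  have h0 := integrable_kernel_mul (integrable_nearKernel r) h.abs.integrable.aestronglyMeasurable
      h.abs.abs_le x
  calc _ ≤ ∫ y, (nearKernel r (x - y) * |w y| + r⁻¹ * |w y|) := by
        apply integral_mono (h.integrable_inv_norm_mul x)
        · exact h0.add (h.integrable.abs.const_mul _)
        · intro y
          dsimp only
          rw [← add_mul]
          gcongr
          exact inv_norm_le_nearKernel hr _
    _ ≤ _ := by
      rw [integral_add h0 (h.integrable.abs.const_mul _), integral_const_mul,
        ← integral_nearKernel hr.le]
      gcongr
      · exact integral_kernel_mul_abs_le (integrable_nearKernel r) (nearKernel_nonneg r)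
          h.abs_le x
      · exact h.integral_abs_le

lemma measurable_inversionPt : Measurable inversionPt := by
  unfold inversionPt; fun_prop

lemma measurable_biotSavartKernel : Measurable fun p : Plane × Plane => biotSavartKernel p.1 p.2 := by
  have h1 : Measurable fun p : Plane × Plane => inversionPt p.2 :=
    measurable_inversionPt.comp measurable_snd
  unfold biotSavartKernel
  fun_prop

lemma measurable_radialKernel : Measurable fun p : Plane × Plane => radialKernel p.1 p.2 :=
  measurable_fst.inner measurable_biotSavartKernel

lemma IsBoundedVorticity.integrable_radialKernel_mul (h : IsBoundedVorticity w A B) {x : Plane}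
    (hx : 1 < ‖x‖) : Integrable fun y => radialKernel x y * w y := by
  refine ((h.integrable_inv_norm_mul x).const_mul ‖x‖).mono' ?_
    (Filter.Eventually.of_forall fun y => ?_)
  · exact (measurable_radialKernel.comp measurable_prodMk_left).aestronglyMeasurable.mul
      h.integrable.aestronglyMeasurable
  · by_cases hy : y ∈ exteriorDisk
    · rw [norm_mul, ← mul_assoc]
      exact mul_le_mul_of_nonneg_right (abs_radialKernel_le_left hx hy) (abs_nonneg _)
    · simp [h.eq_zero y hy]

lemma IsBoundedVorticity.integrable_biotSavartKernel (h : IsBoundedVorticity w A B) {x : Plane}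
    (hx : 1 < ‖x‖) : Integrable fun y => w y • biotSavartKernel x y := by
  refine ((h.integrable_inv_norm_mul x).add (h.integrable.abs.const_mul (‖x‖ - 1)⁻¹)).mono' ?_
    (Filter.Eventually.of_forall fun y => ?_)
  · exact h.integrable.aestronglyMeasurable.smul
      (measurable_biotSavartKernel.comp measurable_prodMk_left).aestronglyMeasurable
  · by_cases hy : y ∈ exteriorDisk
    · rw [norm_smul, mul_comm]
      simp only [Pi.add_apply]
      rw [← add_mul]
      exact mul_le_mul_of_nonneg_right (norm_biotSavartKernel_le hx hy) (abs_nonneg _)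
    · simp [h.eq_zero y hy]

lemma IsBoundedVorticity.velocity_eq (h : IsBoundedVorticity w A B) (α : ℝ) (x : Plane) :
    velocity α w x = (2 * Real.pi)⁻¹ •
      ((∫ y, w y • biotSavartKernel x y) + (α * (‖x‖ ^ 2)⁻¹) • perp x) := by
  rw [velocity, setIntegral_eq_integral_of_forall_compl_eq_zero]
  intro y hy
  simp [h.eq_zero y hy]

/-- The term with $\alpha$ vanishes because $x\cdot x^\perp=0$, so every estimate of the radial
velocity is independent of $\alpha$. -/
lemma IsBoundedVorticity.inner_velocity (h : IsBoundedVorticity w A B) (α : ℝ) {x : Plane}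
    (hx : 1 < ‖x‖) :
    inner ℝ x (velocity α w x) = (2 * Real.pi)⁻¹ * ∫ y, radialKernel x y * w y := by
  have h1 : (inner ℝ x (perp x) : ℝ) = 0 := by rw [plane_inner]; simp; ring
  rw [h.velocity_eq, inner_smul_right, inner_add_right, inner_smul_right, h1,
    ← integral_inner (h.integrable_biotSavartKernel hx)]
  simp only [inner_smul_right, mul_zero, add_zero, radialKernel, mul_comm (w _)]

/-- With $\varepsilon=|x|^2-1$ and $d=|x-y|$, the image term improves $1/d$ to
$\varepsilon(|y|^2-1)/d^3$. For $d\ge\varepsilon$ one has $|y|^2-1\le d+d(4+d)$, so the kernel is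
$O(\varepsilon/d^2)$ when $d<1$ and $O(\varepsilon)$ beyond. -/
lemma abs_radialKernel_near_circle_le {x y : Plane} (hx : 1 < ‖x‖) (hy : 1 < ‖y‖)
    (hx2 : ‖x‖ ^ 2 - 1 < 1 / 4) :
    |radialKernel x y| ≤ 2 * nearKernel (‖x‖ ^ 2 - 1) (x - y) +
      12 * (‖x‖ ^ 2 - 1) * annulusKernel (‖x‖ ^ 2 - 1) (x - y) + 12 * (‖x‖ ^ 2 - 1) := by
  have hP := exterior_product_pos hx hy
  set ε := ‖x‖ ^ 2 - 1 with hε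
  have hε0 : 0 < ε := by nlinarith
  have hx3 : ‖x‖ < 2 := by nlinarith
  have hn := nearKernel_nonneg ε (x - y)
  have ha := annulusKernel_nonneg ε (x - y)
  rcases lt_or_ge ‖x - y‖ ε with hd | hd
  · have h1 := abs_radialKernel_le_left hx hy
    have h2 : nearKernel ε (x - y) = ‖x - y‖⁻¹ := by simp [nearKernel, hd]
    have h3 : ‖x‖ * ‖x - y‖⁻¹ ≤ 2 * ‖x - y‖⁻¹ := by gcongr
    rw [h2]
    linarith [mul_nonneg hε0.le ha]
  · have hd0 : 0 < ‖x - y‖ := hε0.trans_le hd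
    have h4 : |radialKernel x y| ≤ 2 * ε * (‖y‖ ^ 2 - 1) * (‖x - y‖ ^ 3)⁻¹ := by
      rw [abs_radialKernel hx hy, ← hε]
      calc _ ≤ (‖x‖ * ‖x - y‖) * (ε * (‖y‖ ^ 2 - 1) / (‖x - y‖ ^ 2 * ‖x - y‖ ^ 2)) := by
            gcongr
            · exact abs_cross_le_left x y
            · linarith
        _ ≤ (2 * ‖x - y‖) * (ε * (‖y‖ ^ 2 - 1) / (‖x - y‖ ^ 2 * ‖x - y‖ ^ 2)) := by
            have := hP.le
            gcongr
        _ = _ := by field_simp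
    have h5 : ‖y‖ ≤ 2 + ‖x - y‖ := by
      have := norm_sub_norm_le y x
      rw [norm_sub_rev] at this
      linarith
    have h6 : ‖y‖ ^ 2 - 1 ≤ ‖x - y‖ + ‖x - y‖ * (4 + ‖x - y‖) := by
      have h7 := (abs_le.1 (abs_norm_sq_sub_norm_sq_le x y)).1
      have h8 : ‖x - y‖ * (‖x‖ + ‖y‖) ≤ ‖x - y‖ * (4 + ‖x - y‖) :=
        mul_le_mul_of_nonneg_left (by linarith) hd0.le
      linarith
    rcases lt_or_ge ‖x - y‖ 1 with hd1 | hd1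
    · have h9 : annulusKernel ε (x - y) = (‖x - y‖ ^ 2)⁻¹ := by
        simp [annulusKernel, hd, hd1]
      rw [h9]
      have : |radialKernel x y| ≤ 12 * ε * (‖x - y‖ ^ 2)⁻¹ :=
        calc _ ≤ _ := h4
          _ ≤ 2 * ε * (6 * ‖x - y‖) * (‖x - y‖ ^ 3)⁻¹ := by gcongr; nlinarith
          _ = _ := by field_simp; norm_num
      linarith
    · have : |radialKernel x y| ≤ 12 * ε :=
        calc _ ≤ _ := h4
          _ ≤ 2 * ε * (6 * ‖x - y‖ ^ 3) * (‖x - y‖ ^ 3)⁻¹ := by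
            gcongr
            have : ‖x - y‖ ≤ ‖x - y‖ ^ 3 := le_self_pow₀ hd1 (by norm_num)
            have : ‖x - y‖ ^ 2 ≤ ‖x - y‖ ^ 3 := pow_le_pow_right₀ hd1 (by norm_num)
            nlinarith
          _ = _ := by field_simp; norm_num
      linarith [mul_nonneg hε0.le ha]

lemma IsBoundedVorticity.abs_integral_radialKernel_mul_le (h : IsBoundedVorticity w A B)
    {x : Plane} (hx : 1 < ‖x‖) {r : ℝ} (hr : 0 < r) :
    |∫ y, radialKernel x y * w y| ≤ ‖x‖ * (2 * Real.pi * r * B + r⁻¹ * A) := by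
  calc _ ≤ ∫ y, ‖x‖ * (‖x - y‖⁻¹ * |w y|) := by
        refine abs_integral_le_of_abs_le ((h.integrable_inv_norm_mul x).const_mul ‖x‖) fun y => ?_
        by_cases hy : y ∈ exteriorDisk
        · rw [abs_mul, ← mul_assoc]
          exact mul_le_mul_of_nonneg_right (abs_radialKernel_le_left hx hy) (abs_nonneg _)
        · simp [h.eq_zero y hy]
    _ ≤ _ := by
      rw [integral_const_mul]
      gcongr
      exact h.integral_inv_norm_mul_le x hr

/-- The radial velocity is log-Lipschitz at the unit circle. -/
lemma IsBoundedVorticity.abs_integral_radialKernel_mul_le_log (h : IsBoundedVorticity w A B)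
    {x : Plane} (hx : 1 < ‖x‖) :
    |∫ y, radialKernel x y * w y| ≤ (100 * (A + B)) *
      ((‖x‖ ^ 2 - 1) * √(1 + Real.log (‖x‖ ^ 2 - 1) ^ 2)) := by
  have hA := h.nonneg_left
  have hB := h.nonneg_right
  have hπ := Real.pi_lt_four
  have hπ0 := Real.pi_pos
  have hε0 : 0 < ‖x‖ ^ 2 - 1 := by nlinarith
  have hs1 : 1 ≤ √(1 + Real.log (‖x‖ ^ 2 - 1) ^ 2) := by
    rw [Real.one_le_sqrt]; nlinarith [sq_nonneg (Real.log (‖x‖ ^ 2 - 1))]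
  have hs2 : -Real.log (‖x‖ ^ 2 - 1) ≤ √(1 + Real.log (‖x‖ ^ 2 - 1) ^ 2) := by
    apply Real.le_sqrt_of_sq_le; nlinarith
  -- Near the circle the annulus $\varepsilon\le|x-y|<1$ produces the logarithm; away from it
  -- $|x|\le5(|x|^2-1)$ and the crude bound with $r=1$ suffices.
  rcases lt_or_ge (‖x‖ ^ 2 - 1) (1 / 4) with hx2 | hx2
  · set ε := ‖x‖ ^ 2 - 1 with hε
    have i1 := integrable_kernel_mul (integrable_nearKernel ε)
      h.abs.integrable.aestronglyMeasurable h.abs.abs_le x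
    have i2 := integrable_kernel_mul (integrable_annulusKernel hε0)
      h.abs.integrable.aestronglyMeasurable h.abs.abs_le x
    have j1 := integral_kernel_mul_abs_le (integrable_nearKernel ε) (nearKernel_nonneg ε)
      h.abs_le x
    have j2 := integral_kernel_mul_abs_le (integrable_annulusKernel hε0) (annulusKernel_nonneg ε)
      h.abs_le x
    rw [integral_nearKernel hε0.le] at j1
    rw [integral_annulusKernel hε0 (by linarith)] at j2
    have i3 := h.integrable.abs
    have i4 : Integrable fun y => 2 * (nearKernel ε (x - y) * |w y|) +
        12 * ε * (annulusKernel ε (x - y) * |w y|) :=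
      (i1.const_mul 2).add (i2.const_mul (12 * ε))
    calc _ ≤ ∫ y, (2 * (nearKernel ε (x - y) * |w y|) +
          12 * ε * (annulusKernel ε (x - y) * |w y|) + 12 * ε * |w y|) := by
          refine abs_integral_le_of_abs_le (i4.add (i3.const_mul (12 * ε))) fun y => ?_
          by_cases hy : y ∈ exteriorDisk
          · rw [abs_mul]
            have := mul_le_mul_of_nonneg_right (abs_radialKernel_near_circle_le hx hy hx2)
              (abs_nonneg (w y))
            linarith
          · simp [h.eq_zero y hy]
      _ = 2 * (∫ y, nearKernel ε (x - y) * |w y|) +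
          12 * ε * (∫ y, annulusKernel ε (x - y) * |w y|) + 12 * ε * ∫ y, |w y| := by
          rw [integral_add i4 (i3.const_mul (12 * ε)),
            integral_add (i1.const_mul 2) (i2.const_mul (12 * ε)), integral_const_mul,
            integral_const_mul, integral_const_mul]
      _ ≤ 2 * (2 * Real.pi * ε * B) + 12 * ε * (2 * Real.pi * (-Real.log ε) * B) +
          12 * ε * A := by
          gcongr
          exact h.integral_abs_le
      _ ≤ 2 * (2 * Real.pi * ε * B) * √(1 + Real.log ε ^ 2) +
          12 * ε * (2 * Real.pi * √(1 + Real.log ε ^ 2) * B) +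
          12 * ε * A * √(1 + Real.log ε ^ 2) := by
          gcongr ?_ + ?_ + ?_
          · exact le_mul_of_one_le_right (by positivity) hs1
          · gcongr
          · exact le_mul_of_one_le_right (by positivity) hs1
      _ = (28 * Real.pi * B + 12 * A) * (ε * √(1 + Real.log ε ^ 2)) := by ring
      _ ≤ _ := by
          gcongr
          have : Real.pi < 3.15 := Real.pi_lt_d2
          nlinarith
  · have h1 := h.abs_integral_radialKernel_mul_le hx one_pos
    have h2 : ‖x‖ ≤ 5 * (‖x‖ ^ 2 - 1) := by nlinarith
    calc _ ≤ _ := h1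
      _ ≤ (5 * (‖x‖ ^ 2 - 1)) * (20 * (A + B)) := by
        gcongr
        nlinarith
      _ = (100 * (A + B)) * ((‖x‖ ^ 2 - 1) * 1) := by ring
      _ ≤ _ := by gcongr

end

/-! ### The velocity field is weakly divergence free. -/

/-- Rotation of the plane by the angle `θ`. -/
noncomputable def planeRotation (θ : ℝ) : Plane →ₗᵢ[ℝ] Plane where
  toFun x := Real.cos θ • x + Real.sin θ • perp x
  map_add' x y := by simp only [perp_add, smul_add]; abel
  map_smul' c x := by simp only [perp_smul, smul_add, smul_comm c, RingHom.id_apply]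
  norm_map' x := by
    have h : ‖Real.cos θ • x + Real.sin θ • perp x‖ ^ 2 = ‖x‖ ^ 2 := by
      rw [plane_norm_sq, plane_norm_sq]
      simp
      linear_combination (x 0 ^ 2 + x 1 ^ 2) * Real.sin_sq_add_cos_sq θ
    exact (pow_left_inj₀ (norm_nonneg _) (norm_nonneg _) two_ne_zero).1 h

lemma planeRotation_apply (θ : ℝ) (x : Plane) :
    planeRotation θ x = Real.cos θ • x + Real.sin θ • perp x := rfl

lemma measurePreserving_planeRotation (θ : ℝ) :
    MeasurePreserving (planeRotation θ) volume volume :=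
  ((planeRotation θ).toLinearIsometryEquiv rfl).measurePreserving

lemma measurableEmbedding_planeRotation (θ : ℝ) : MeasurableEmbedding (planeRotation θ) :=
  ((planeRotation θ).toLinearIsometryEquiv rfl).toHomeomorph.measurableEmbedding

lemma continuous_planeRotation : Continuous fun p : ℝ × Plane => planeRotation p.1 p.2 := by
  simp only [planeRotation_apply]; fun_prop

lemma continuous_planeRotation_left (x : Plane) : Continuous fun θ => planeRotation θ x := by
  simp only [planeRotation_apply]; fun_prop

lemma hasDerivAt_planeRotation (x : Plane) (θ : ℝ) :
    HasDerivAt (fun θ => planeRotation θ x) (perp (planeRotation θ x)) θ := by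
  simp only [planeRotation_apply]
  have h := ((Real.hasDerivAt_cos θ).smul_const x).add
    ((Real.hasDerivAt_sin θ).smul_const (perp x))
  refine HasDerivAt.congr_deriv h ?_
  rw [perp_add, perp_smul, perp_smul, perp_perp]
  simp [add_comm]

section
variable {g : Plane → ℝ}

lemma measurable_rotational_derivative (hg : ContDiff ℝ 1 g) :
    Measurable fun z : Plane => (‖z‖ ^ 2)⁻¹ * fderiv ℝ g z (perp z) := by
  have : Continuous fun z : Plane => fderiv ℝ g z (perp z) :=
    (hg.continuous_fderiv one_ne_zero).clm_apply continuous_perp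
  fun_prop

lemma exists_rotational_derivative_bound (hg : ContDiff ℝ 1 g) (hc : HasCompactSupport g) :
    ∃ C r : ℝ, ∀ z : Plane,
      ‖(‖z‖ ^ 2)⁻¹ * fderiv ℝ g z (perp z)‖ ≤ C * nearKernel r z := by
  obtain ⟨C, hC⟩ := (hg.continuous_fderiv one_ne_zero).bounded_above_of_compact_support
    (hc.fderiv ℝ)
  obtain ⟨r, hr⟩ := hc.isCompact.isBounded.subset_ball 0
  refine ⟨C, r, fun z => ?_⟩
  have hC0 : 0 ≤ C := (norm_nonneg _).trans (hC 0)
  by_cases hz : z ∈ tsupport g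
  · have hzr : ‖z‖ < r := by simpa using hr hz
    have h1 : nearKernel r z = ‖z‖⁻¹ := by simp [nearKernel, hzr]
    rw [h1]
    calc _ ≤ (‖z‖ ^ 2)⁻¹ * (C * ‖z‖) := by
          rw [norm_mul, norm_inv, norm_pow, norm_norm]
          gcongr
          refine ((fderiv ℝ g z).le_opNorm _).trans ?_
          rw [norm_perp]
          gcongr
          exact hC z
      _ ≤ C * ‖z‖⁻¹ := by
          rcases eq_or_ne ‖z‖ 0 with h | h
          · simp [h]
          · apply le_of_eq; field_simp
  · have : fderiv ℝ g z = 0 := by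
      by_contra h
      exact hz (support_fderiv_subset ℝ h)
    rw [this]
    simpa using mul_nonneg hC0 (nearKernel_nonneg r z)

lemma integrable_rotational_derivative (hg : ContDiff ℝ 1 g) (hc : HasCompactSupport g) :
    Integrable fun z : Plane => (‖z‖ ^ 2)⁻¹ * fderiv ℝ g z (perp z) := by
  obtain ⟨C, r, h⟩ := exists_rotational_derivative_bound hg hc
  exact ((integrable_nearKernel r).const_mul C).mono'
    (measurable_rotational_derivative hg).aestronglyMeasurable (Filter.Eventually.of_forall h)

/-- Rotations preserve area, so by Fubini $2\pi\int h$ is the integral over $z$ of the mean-zero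
rotation averages. The radial majorant justifies the exchange. -/
lemma integral_eq_zero_of_integral_planeRotation_eq_zero {h : Plane → ℝ} (hmeas : Measurable h)
    {C r : ℝ} (hb : ∀ z, ‖h z‖ ≤ C * nearKernel r z)
    (hinner : ∀ z : Plane, ∫ θ in Ioc 0 (2 * Real.pi), h (planeRotation θ z) = 0) :
    ∫ z, h z = 0 := by
  have hrot : ∀ θ, ∫ z, h (planeRotation θ z) = ∫ z, h z := fun θ =>
    (measurePreserving_planeRotation θ).integral_comp (measurableEmbedding_planeRotation θ) h
  have hint : Integrable (Function.uncurry fun (θ : ℝ) (z : Plane) => h (planeRotation θ z))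
      ((volume.restrict (Ioc 0 (2 * Real.pi))).prod volume) := by
    have h1 : Integrable (fun p : ℝ × Plane => (1 : ℝ) * (C * nearKernel r p.2))
        ((volume.restrict (Ioc 0 (2 * Real.pi))).prod volume) :=
      Integrable.mul_prod (f := fun _ : ℝ => (1 : ℝ)) (integrable_const _)
        ((integrable_nearKernel r).const_mul C)
    refine h1.mono' (hmeas.comp continuous_planeRotation.measurable).aestronglyMeasurable
      (Filter.Eventually.of_forall fun p => ?_)
    refine (hb _).trans (le_of_eq ?_)
    rw [one_mul, nearKernel, nearKernel, LinearIsometry.norm_map]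
  have hswap := integral_integral_swap hint
  simp only [hrot, hinner] at hswap
  have hpos : (volume.restrict (Ioc 0 (2 * Real.pi))).real univ ≠ 0 := by
    simp [Measure.real, ENNReal.toReal_ofReal Real.pi_pos.le, Real.pi_ne_zero]
  simpa only [integral_const, integral_zero, smul_eq_mul, mul_zero, mul_eq_zero, hpos,
    false_or] using hswap

/-- The point vortex velocity field centred at the origin is weakly divergence free. -/
lemma integral_rotational_derivative (hg : ContDiff ℝ 1 g) (hc : HasCompactSupport g) :
    ∫ z : Plane, (‖z‖ ^ 2)⁻¹ * fderiv ℝ g z (perp z) = 0 := by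
  obtain ⟨C, r, hb⟩ := exists_rotational_derivative_bound hg hc
  refine integral_eq_zero_of_integral_planeRotation_eq_zero
    (h := fun z => (‖z‖ ^ 2)⁻¹ * fderiv ℝ g z (perp z))
    (measurable_rotational_derivative hg) hb fun z => ?_
  -- Differentiation along $z^\perp$ is the angular derivative and the weight is radial, so the
  -- integrand is an exact derivative on each circle and the singularity at $0$ needs no separate
  -- treatment.
  have hr : ∀ θ, HasDerivAt (fun θ => g (planeRotation θ z))
      (fderiv ℝ g (planeRotation θ z) (perp (planeRotation θ z))) θ := by
    intro θ
    have h1 := ((hg.differentiable one_ne_zero) (planeRotation θ z)).hasFDerivAt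
    exact h1.comp_hasDerivAt θ (hasDerivAt_planeRotation z θ)
  have hd : ∀ θ, HasDerivAt (fun θ => (‖z‖ ^ 2)⁻¹ * g (planeRotation θ z))
      ((‖z‖ ^ 2)⁻¹ * fderiv ℝ g (planeRotation θ z) (perp (planeRotation θ z))) θ := fun θ =>
    (hr θ).const_mul _
  have h3 := continuous_planeRotation_left z
  have hcont : Continuous fun θ =>
      (‖z‖ ^ 2)⁻¹ * fderiv ℝ g (planeRotation θ z) (perp (planeRotation θ z)) :=
    continuous_const.mul (((hg.continuous_fderiv one_ne_zero).comp h3).clm_apply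
      (continuous_perp.comp h3))
  simp only [LinearIsometry.norm_map]
  rw [← intervalIntegral.integral_of_le Real.two_pi_pos.le,
    intervalIntegral.integral_eq_sub_of_hasDerivAt (fun θ _ => hd θ)
      (hcont.intervalIntegrable _ _)]
  simp [planeRotation_apply]

lemma fderiv_comp_add (a x v : Plane) :
    fderiv ℝ (fun z => g (z + a)) x v = fderiv ℝ g (x + a) v := by
  rw [fderiv_comp_add_right]

lemma integrable_point_vortex (hg : ContDiff ℝ 1 g) (hc : HasCompactSupport g) (a : Plane) :
    Integrable fun x => fderiv ℝ g x ((‖x - a‖ ^ 2)⁻¹ • perp (x - a)) := by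
  have h := (integrable_rotational_derivative (g := fun z => g (z + a))
    (hg.comp (contDiff_id.add contDiff_const))
    (hc.comp_homeomorph (Homeomorph.addRight a))).comp_sub_right a
  simpa [fderiv_comp_add] using h

lemma integral_point_vortex (hg : ContDiff ℝ 1 g) (hc : HasCompactSupport g) (a : Plane) :
    ∫ x, fderiv ℝ g x ((‖x - a‖ ^ 2)⁻¹ • perp (x - a)) = 0 := by
  have h := integral_rotational_derivative (g := fun z => g (z + a))
    (hg.comp (contDiff_id.add contDiff_const))
    (hc.comp_homeomorph (Homeomorph.addRight a))
  rw [← integral_sub_right_eq_self _ a] at h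
  simpa [fderiv_comp_add] using h

/-- Integrability on the product, needed for Fubini. The support of `g` stays at distance `δ` from
the circle, which bounds the image term by $1/\delta$. -/
lemma integrable_fderiv_biotSavartKernel (hg : ContDiff ℝ 1 g) (hc : HasCompactSupport g)
    (hs : tsupport g ⊆ exteriorDisk) {w : Plane → ℝ} {A B : ℝ} (h : IsBoundedVorticity w A B) :
    Integrable (fun p : Plane × Plane => w p.2 * fderiv ℝ g p.1 (biotSavartKernel p.1 p.2))
      (volume.prod volume) := by
  obtain ⟨C, hC⟩ := (hg.continuous_fderiv one_ne_zero).bounded_above_of_compact_support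
    (hc.fderiv ℝ)
  have hC0 : 0 ≤ C := (norm_nonneg _).trans (hC 0)
  obtain ⟨δ, hδ, hδs⟩ : ∃ δ > 0, ∀ x ∈ tsupport g, δ ≤ ‖x‖ - 1 := by
    rcases (tsupport g).eq_empty_or_nonempty with he | hne
    · exact ⟨1, one_pos, by simp [he]⟩
    · obtain ⟨x, hx, hmin⟩ := hc.isCompact.exists_isMinOn hne continuous_norm.continuousOn
      exact ⟨‖x‖ - 1, sub_pos.2 (hs hx), fun y hy => sub_le_sub_right (hmin hy) 1⟩
  have i1 : Integrable (fun p : Plane × Plane => |w p.2| * nearKernel 1 (p.1 - p.2))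
      (volume.prod volume) :=
    h.integrable.abs.convolution_integrand (ContinuousLinearMap.mul ℝ ℝ) (integrable_nearKernel 1)
  have i2 : Integrable (fun p : Plane × Plane => (tsupport g).indicator (fun _ => (1 : ℝ)) p.1 *
      |w p.2|) (volume.prod volume) :=
    Integrable.mul_prod (f := (tsupport g).indicator (fun _ => (1 : ℝ)))
      ((integrable_indicator_iff hc.isCompact.measurableSet).2
        (integrableOn_const hc.isCompact.measure_lt_top.ne)) h.integrable.abs
  refine ((i1.const_mul C).add (i2.const_mul (C * (1 + δ⁻¹)))).mono' ?_
    (Filter.Eventually.of_forall fun p => ?_)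
  · refine h.integrable.aestronglyMeasurable.comp_snd.mul (Measurable.aestronglyMeasurable ?_)
    have h1 : Measurable fun p : Plane × Plane => fderiv ℝ g p.1 :=
      ((hg.continuous_fderiv one_ne_zero).comp continuous_fst).measurable
    have h2 : Continuous fun q : (Plane →L[ℝ] ℝ) × Plane => q.1 q.2 := by fun_prop
    exact h2.measurable.comp (h1.prodMk measurable_biotSavartKernel)
  · obtain ⟨x, y⟩ := p
    simp only [Pi.add_apply]
    by_cases hy : y ∈ exteriorDisk
    · by_cases hx : x ∈ tsupport g
      · rw [indicator_of_mem hx, norm_mul, Real.norm_eq_abs]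
        have hK : ‖biotSavartKernel x y‖ ≤ nearKernel 1 (x - y) + 1 + δ⁻¹ := by
          refine (norm_biotSavartKernel_le (hs hx) hy).trans ?_
          have := inv_norm_le_nearKernel one_pos (x - y)
          rw [inv_one] at this
          gcongr
          exact hδs x hx
        calc _ ≤ |w y| * (C * (nearKernel 1 (x - y) + 1 + δ⁻¹)) := by
              gcongr
              refine ((fderiv ℝ g x).le_opNorm _).trans ?_
              gcongr
              exact hC x
          _ = _ := by ring
      · have : fderiv ℝ g x = 0 := by
          by_contra h
          exact hx (support_fderiv_subset ℝ h)
        rw [this, indicator_of_notMem hx]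
        have := nearKernel_nonneg 1 (x - y)
        simp only [zero_apply, mul_zero, norm_zero, zero_mul, add_zero]
        positivity
    · simp [h.eq_zero y hy]

lemma fderiv_eq_zero_of_notMem_exteriorDisk (hs : tsupport g ⊆ exteriorDisk) {x : Plane}
    (hx : x ∉ exteriorDisk) : fderiv ℝ g x = 0 := by
  by_contra h
  exact hx (hs (support_fderiv_subset ℝ h))

/-- The harmonic term is a point vortex at the origin; writing `x - 0` puts it in the form of
`integral_point_vortex`. -/
lemma fderiv_velocity_eq (hs : tsupport g ⊆ exteriorDisk) {w : Plane → ℝ} {A B : ℝ}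
    (h : IsBoundedVorticity w A B) (α : ℝ) (x : Plane) :
    fderiv ℝ g x (velocity α w x) = (2 * Real.pi)⁻¹ *
      ((∫ y, w y * fderiv ℝ g x (biotSavartKernel x y)) +
        α * fderiv ℝ g x ((‖x - 0‖ ^ 2)⁻¹ • perp (x - 0))) := by
  by_cases hx : x ∈ exteriorDisk
  · rw [h.velocity_eq, map_smul, map_add, ← ContinuousLinearMap.integral_comp_comm _
      (h.integrable_biotSavartKernel hx)]
    simp [mul_assoc]
  · simp [fderiv_eq_zero_of_notMem_exteriorDisk hs hx]

lemma integrable_fderiv_velocity (hg : ContDiff ℝ 1 g) (hc : HasCompactSupport g)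
    (hs : tsupport g ⊆ exteriorDisk) {w : Plane → ℝ} {A B : ℝ} (h : IsBoundedVorticity w A B)
    (α : ℝ) : Integrable fun x => fderiv ℝ g x (velocity α w x) := by
  simp only [fderiv_velocity_eq hs h α]
  exact (((integrable_fderiv_biotSavartKernel hg hc hs h).integral_prod_left).add
    ((integrable_point_vortex hg hc 0).const_mul α)).const_mul _

/-- The velocity field is weakly divergence free. -/
lemma integral_fderiv_velocity (hg : ContDiff ℝ 1 g) (hc : HasCompactSupport g)
    (hs : tsupport g ⊆ exteriorDisk) {w : Plane → ℝ} {A B : ℝ} (h : IsBoundedVorticity w A B)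
    (α : ℝ) : ∫ x, fderiv ℝ g x (velocity α w x) = 0 := by
  have i := integrable_fderiv_biotSavartKernel hg hc hs h
  simp only [fderiv_velocity_eq hs h α]
  rw [integral_const_mul, integral_add i.integral_prod_left
    ((integrable_point_vortex hg hc 0).const_mul α), integral_const_mul,
    integral_point_vortex hg hc 0,
    integral_integral_swap (f := fun x y => w y * fderiv ℝ g x (biotSavartKernel x y)) i]
  -- For fixed $y$ the kernel is a difference of point vortices at $y$ and $y^*$, each weakly
  -- divergence free in the whole plane.
  have : ∀ y, ∫ x, w y * fderiv ℝ g x (biotSavartKernel x y) = 0 := by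
    intro y
    simp only [biotSavartKernel, map_sub]
    rw [integral_const_mul, integral_sub (integrable_point_vortex hg hc y)
      (integrable_point_vortex hg hc _), integral_point_vortex hg hc, integral_point_vortex hg hc]
    simp
  simp [this]

end

/-! ### Differentiating integrals of compactly supported densities. -/

lemma isOpen_exteriorDisk : IsOpen exteriorDisk :=
  isOpen_lt continuous_const continuous_norm

lemma contDiff_of_contDiffOn_of_eq_zero {g : Plane → ℝ} {K : Set Plane} (hK : IsCompact K)
    (hKD : K ⊆ exteriorDisk) (hg : ContDiffOn ℝ 1 g exteriorDisk) (h0 : ∀ x, x ∉ K → g x = 0) :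
    ContDiff ℝ 1 g ∧ HasCompactSupport g ∧ tsupport g ⊆ exteriorDisk := by
  have hs : tsupport g ⊆ K := closure_minimal
    (fun x hx => by_contra fun h => hx (h0 x h)) hK.isClosed
  refine ⟨contDiff_iff_contDiffAt.2 fun x => ?_, HasCompactSupport.intro hK h0, hs.trans hKD⟩
  by_cases hx : x ∈ K
  · exact hg.contDiffAt (isOpen_exteriorDisk.mem_nhds (hKD hx))
  · refine (contDiffAt_const (c := (0 : ℝ))).congr_of_eventuallyEq ?_
    filter_upwards [hK.isClosed.isOpen_compl.mem_nhds hx] with y hy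
    exact h0 y hy

section
variable {G : ℝ → Plane → ℝ} {K : Set Plane} {T : ℝ}

lemma isOpen_positive_time : IsOpen (Ioi (0 : ℝ) ×ˢ exteriorDisk) :=
  isOpen_Ioi.prod isOpen_exteriorDisk

lemma contDiffAt_uncurry_of_contDiffOn
    (hG : ContDiffOn ℝ 1 (fun p : ℝ × Plane => G p.1 p.2) (Ici 0 ×ˢ exteriorDisk))
    {t : ℝ} (ht : 0 < t) {x : Plane} (hx : x ∈ exteriorDisk) :
    ContDiffAt ℝ 1 (fun p : ℝ × Plane => G p.1 p.2) (t, x) :=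
  hG.contDiffAt (Filter.mem_of_superset (isOpen_positive_time.mem_nhds ⟨ht, hx⟩)
    (prod_mono Ioi_subset_Ici_self subset_rfl))

lemma contDiffOn_space_slice
    (hG : ContDiffOn ℝ 1 (fun p : ℝ × Plane => G p.1 p.2) (Ici 0 ×ˢ exteriorDisk))
    {t : ℝ} (ht : 0 ≤ t) : ContDiffOn ℝ 1 (G t) exteriorDisk :=
  hG.comp (contDiff_prodMk_right t).contDiffOn fun _ hx => ⟨ht, hx⟩

lemma hasDerivAt_time_slice
    (hG : ContDiffOn ℝ 1 (fun p : ℝ × Plane => G p.1 p.2) (Ici 0 ×ˢ exteriorDisk))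
    {t : ℝ} (ht : 0 < t) {x : Plane} (hx : x ∈ exteriorDisk) :
    HasDerivAt (fun s => G s x) (fderiv ℝ (fun p : ℝ × Plane => G p.1 p.2) (t, x) (1, 0)) t := by
  have h1 := ((contDiffAt_uncurry_of_contDiffOn hG ht hx).differentiableAt one_ne_zero).hasFDerivAt
  have h2 : HasDerivAt (fun s : ℝ => (s, x)) ((1 : ℝ), (0 : Plane)) t :=
    (hasDerivAt_id t).prodMk (hasDerivAt_const t x)
  exact h1.comp_hasDerivAt t h2

lemma differentiableAt_time_slice
    (hG : ContDiffOn ℝ 1 (fun p : ℝ × Plane => G p.1 p.2) (Ici 0 ×ˢ exteriorDisk))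
    {t : ℝ} (ht : 0 < t) {x : Plane} (hx : x ∈ exteriorDisk) :
    DifferentiableAt ℝ (fun s => G s x) t :=
  (hasDerivAt_time_slice hG ht hx).differentiableAt

lemma differentiableAt_space_slice
    (hG : ContDiffOn ℝ 1 (fun p : ℝ × Plane => G p.1 p.2) (Ici 0 ×ˢ exteriorDisk))
    {t : ℝ} (ht : 0 ≤ t) {x : Plane} (hx : x ∈ exteriorDisk) :
    DifferentiableAt ℝ (G t) x :=
  ((contDiffOn_space_slice hG ht).contDiffAt (isOpen_exteriorDisk.mem_nhds hx)).differentiableAt one_ne_zero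

lemma continuousOn_integral_of_eq_zero_off_compact
    (hG : ContDiffOn ℝ 1 (fun p : ℝ × Plane => G p.1 p.2) (Ici 0 ×ˢ exteriorDisk))
    (hK : IsCompact K) (hKD : K ⊆ exteriorDisk)
    (h0 : ∀ t ∈ Icc 0 T, ∀ x, x ∉ K → G t x = 0) :
    ContinuousOn (fun t => ∫ x, G t x) (Icc 0 T) := by
  refine continuousOn_integral_of_compact_support hK ?_ fun p x hp hx => h0 p hp x hx
  rintro ⟨t, x⟩ ⟨ht, -⟩
  by_cases hx : x ∈ exteriorDisk
  · have h1 : ContinuousWithinAt (fun p : ℝ × Plane => G p.1 p.2) (Ici 0 ×ˢ exteriorDisk) (t, x) :=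
      hG.continuousOn (t, x) ⟨ht.1, hx⟩
    refine h1.mono_of_mem_nhdsWithin ?_
    rw [nhdsWithin_prod_eq]
    exact Filter.prod_mem_prod (Filter.mem_of_superset self_mem_nhdsWithin Icc_subset_Ici_self)
      (mem_nhdsWithin_of_mem_nhds (isOpen_exteriorDisk.mem_nhds hx))
  · have h2 : (Icc 0 T ×ˢ Kᶜ) ∈ nhdsWithin (t, x) (Icc 0 T ×ˢ univ) := by
      rw [nhdsWithin_prod_eq]
      exact Filter.prod_mem_prod self_mem_nhdsWithin
        (mem_nhdsWithin_of_mem_nhds (hK.isClosed.isOpen_compl.mem_nhds fun h => hx (hKD h)))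
    have h3 : ContinuousWithinAt (fun _ : ℝ × Plane => (0 : ℝ)) (Icc 0 T ×ˢ univ) (t, x) :=
      continuousWithinAt_const
    refine h3.congr_of_eventuallyEq ?_ (h0 t ht x fun h => hx (hKD h))
    filter_upwards [h2] with p hp
    exact h0 p.1 hp.1 p.2 hp.2

lemma hasDerivAt_integral_of_eq_zero_off_compact
    (hG : ContDiffOn ℝ 1 (fun p : ℝ × Plane => G p.1 p.2) (Ici 0 ×ˢ exteriorDisk))
    (hK : IsCompact K) (hKD : K ⊆ exteriorDisk)
    (h0 : ∀ t ∈ Icc 0 T, ∀ x, x ∉ K → G t x = 0) {t : ℝ} (ht : t ∈ Ioo 0 T) :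
    Integrable (fun x => deriv (fun s => G s x) t) ∧
      HasDerivAt (fun t => ∫ x, G t x) (∫ x, deriv (fun s => G s x) t) t := by
  have hzero : ∀ s ∈ Ioo 0 T, ∀ x, x ∉ K → HasDerivAt (fun s => G s x) 0 s := by
    intro s hs x hx
    refine (hasDerivAt_const s (0 : ℝ)).congr_of_eventuallyEq ?_
    filter_upwards [isOpen_Ioo.mem_nhds hs] with r hr
    exact h0 r ⟨hr.1.le, hr.2.le⟩ x hx
  have hdiff : ∀ s ∈ Ioo 0 T, ∀ x, HasDerivAt (fun s => G s x) (deriv (fun s => G s x) s) s := by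
    intro s hs x
    by_cases hx : x ∈ K
    · exact (differentiableAt_time_slice hG hs.1 (hKD hx)).hasDerivAt
    · rw [(hzero s hs x hx).deriv]; exact hzero s hs x hx
  have hcont : ContinuousOn (fun p : ℝ × Plane => deriv (fun s => G s p.2) p.1)
      (Ioi 0 ×ˢ exteriorDisk) := by
    have h1 : ContinuousOn (fderiv ℝ fun p : ℝ × Plane => G p.1 p.2) (Ioi 0 ×ˢ exteriorDisk) :=
      (hG.mono (prod_mono Ioi_subset_Ici_self subset_rfl)).continuousOn_fderiv_of_isOpen
        isOpen_positive_time le_rfl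
    have h2 : ContinuousOn (fun p : ℝ × Plane =>
        fderiv ℝ (fun p : ℝ × Plane => G p.1 p.2) p ((1 : ℝ), (0 : Plane)))
        (Ioi 0 ×ˢ exteriorDisk) := h1.clm_apply continuousOn_const
    exact h2.congr fun p hp => (hasDerivAt_time_slice hG hp.1 hp.2).deriv
  obtain ⟨a, ha0, hat⟩ := exists_between ht.1
  obtain ⟨b, htb, hbT⟩ := exists_between ht.2
  have hsub : Ioo a b ⊆ Ioo 0 T := Ioo_subset_Ioo ha0.le hbT.le
  have hcK : ContinuousOn (fun p : ℝ × Plane => deriv (fun s => G s p.2) p.1) (Icc a b ×ˢ K) :=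
    hcont.mono (prod_mono (fun s (hs : s ∈ Icc a b) => ha0.trans_le hs.1) hKD)
  obtain ⟨C, hC⟩ := (isCompact_Icc.prod hK).exists_bound_of_continuousOn hcK
  have hslice : ∀ s ∈ Icc 0 T, ContDiff ℝ 1 (G s) ∧ HasCompactSupport (G s) ∧
      tsupport (G s) ⊆ exteriorDisk := fun s hs =>
    contDiff_of_contDiffOn_of_eq_zero (g := G s) hK hKD (contDiffOn_space_slice hG hs.1) (h0 s hs)
  refine hasDerivAt_integral_of_dominated_loc_of_deriv_le (μ := (volume : Measure Plane)) (s := Ioo a b)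
    (F := fun s x => G s x) (F' := fun s x => deriv (fun r => G r x) s)
    (bound := K.indicator fun _ => C) (isOpen_Ioo.mem_nhds ⟨hat, htb⟩) ?_ ?_ ?_ ?_ ?_ ?_
  · filter_upwards [isOpen_Ioo.mem_nhds ht] with s hs
    exact (hslice s (Ioo_subset_Icc_self hs)).1.continuous.aestronglyMeasurable
  · have := hslice t (Ioo_subset_Icc_self ht)
    exact this.1.continuous.integrable_of_hasCompactSupport this.2.1
  · have h1 : ContinuousOn (fun x => deriv (fun s => G s x) t) K :=
      hcont.comp (f := fun x => (t, x)) (by fun_prop) fun x hx => ⟨ht.1, hKD hx⟩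
    have h2 : (fun x => deriv (fun s => G s x) t) =
        K.indicator (fun x => deriv (fun s => G s x) t) := by
      ext x
      by_cases hx : x ∈ K
      · simp [hx]
      · simp [hx, (hzero t ht x hx).deriv]
    rw [h2, aestronglyMeasurable_indicator_iff hK.measurableSet]
    exact h1.aestronglyMeasurable hK.measurableSet
  · refine Filter.Eventually.of_forall fun x s hs => ?_
    by_cases hx : x ∈ K
    · rw [indicator_of_mem hx]
      exact hC (s, x) ⟨Ioo_subset_Icc_self hs, hx⟩
    · rw [indicator_of_notMem hx, (hzero s (hsub hs) x hx).deriv, norm_zero]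
  · exact (integrable_indicator_iff hK.measurableSet).2
      (integrableOn_const hK.measure_lt_top.ne)
  · exact Filter.Eventually.of_forall fun x s hs => hdiff s (hsub hs) x

/-- Differentiation of a compactly supported density, rewritten with the material derivative
along a velocity field of the class considered. -/
lemma hasDerivAt_integral_material
    (hG : ContDiffOn ℝ 1 (fun p : ℝ × Plane => G p.1 p.2) (Ici 0 ×ˢ exteriorDisk))
    (hK : IsCompact K) (hKD : K ⊆ exteriorDisk)
    (h0 : ∀ t ∈ Icc 0 T, ∀ x, x ∉ K → G t x = 0) {t : ℝ} (ht : t ∈ Ioo 0 T)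
    {w : Plane → ℝ} {A B : ℝ} (hw : IsBoundedVorticity w A B) (α : ℝ) :
    Integrable (fun x => deriv (fun s => G s x) t + fderiv ℝ (G t) x (velocity α w x)) ∧
      HasDerivAt (fun t => ∫ x, G t x)
        (∫ x, (deriv (fun s => G s x) t + fderiv ℝ (G t) x (velocity α w x))) t := by
  obtain ⟨h1, h2⟩ := hasDerivAt_integral_of_eq_zero_off_compact hG hK hKD h0 ht
  have ht' := Ioo_subset_Icc_self ht
  obtain ⟨g1, g2, g3⟩ := contDiff_of_contDiffOn_of_eq_zero hK hKD (contDiffOn_space_slice hG ht'.1) (h0 t ht')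
  have h3 := integrable_fderiv_velocity g1 g2 g3 hw α
  refine ⟨h1.add h3, ?_⟩
  -- The term $\int u\cdot\nabla G$ is zero, so it may be added to complete the material derivative.
  rwa [integral_add h1 h3, integral_fderiv_velocity g1 g2 g3 hw α, add_zero]

end

/-! ### Extension by zero and the weak form of transport. -/

/-- A classical solution extended by zero to the closed unit disk. -/
structure IsExtendedSolution (α : ℝ) (ω₀ : Plane → ℝ) (ω : ℝ → Plane → ℝ) : Prop where
  solution : IsExteriorEulerSolution α ω₀ ω
  eq_zero : ∀ t x, x ∉ exteriorDisk → ω t x = 0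

lemma velocity_congr {w w' : Plane → ℝ} (h : EqOn w w' exteriorDisk) (α : ℝ) :
    velocity α w = velocity α w' := by
  ext1 x
  simp only [velocity]
  rw [setIntegral_congr_fun isOpen_exteriorDisk.measurableSet
    (fun y hy => by simp only [h hy] : EqOn (fun y => w y • biotSavartKernel x y)
      (fun y => w' y • biotSavartKernel x y) exteriorDisk)]

lemma IsExteriorEulerSolution.extend {α : ℝ} {ω₀ : Plane → ℝ} {ω : ℝ → Plane → ℝ}
    (h : IsExteriorEulerSolution α ω₀ ω) :
    IsExtendedSolution α ω₀ (fun t => exteriorDisk.indicator (ω t)) := by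
  have heq : ∀ t, EqOn (exteriorDisk.indicator (ω t)) (ω t) exteriorDisk := fun t =>
    eqOn_indicator
  have hm := isOpen_exteriorDisk.measurableSet
  refine ⟨⟨h.contDiffOn.congr fun p hp => heq p.1 hp.2, fun T => ?_, fun t ht x hx => ?_,
    fun x hx => (heq 0 hx).trans (h.initial x hx)⟩, fun t x hx => indicator_of_notMem hx _⟩
  · obtain ⟨C, hC⟩ := h.bounded T
    refine ⟨C, fun t ht => ?_⟩
    obtain ⟨h1, h2, h3⟩ := hC t ht
    refine ⟨fun x hx => by rw [heq t hx]; exact h1 x hx, h2.congr_fun (heq t).symm hm, ?_⟩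
    rwa [setIntegral_congr_fun hm (fun x hx => by simp only [heq t hx] :
      EqOn (fun x => |exteriorDisk.indicator (ω t) x|) (fun x => |ω t x|) exteriorDisk)]
  · have h1 := h.transport t ht x hx
    rw [velocity_congr (heq t), ((heq t).eventuallyEq_of_mem
      (isOpen_exteriorDisk.mem_nhds hx)).fderiv_eq]
    simpa only [indicator_of_mem hx] using h1

section
variable {α : ℝ} {ω₀ : Plane → ℝ} {ω : ℝ → Plane → ℝ}

lemma IsExtendedSolution.exists_bound (h : IsExtendedSolution α ω₀ ω) (T : ℝ) :
    ∃ A B : ℝ, ∀ t ∈ Icc 0 T, IsBoundedVorticity (ω t) A B := by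
  obtain ⟨C, hC⟩ := h.solution.bounded T
  refine ⟨C, max C 0, fun t ht => ?_⟩
  obtain ⟨h1, h2, h3⟩ := hC t ht
  refine ⟨h.eq_zero t, ?_, ?_, fun x => ?_⟩
  · rwa [integrableOn_iff_integrable_of_support_subset] at h2
    intro x hx
    by_contra hn
    exact hx (h.eq_zero t x hn)
  · rwa [setIntegral_eq_integral_of_forall_compl_eq_zero] at h3
    intro x hx
    simp [h.eq_zero t x hx]
  · by_cases hx : x ∈ exteriorDisk
    · exact (h1 x hx).trans (le_max_left _ _)
    · simp [h.eq_zero t x hx]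

/-- Evolution of the integral of a function of the vorticity against a test function. -/
lemma IsExtendedSolution.hasDerivAt_integral (h : IsExtendedSolution α ω₀ ω) {β : ℝ → ℝ}
    (hβ : ContDiff ℝ 1 β) (hβ0 : β 0 = 0) {φ : ℝ → Plane → ℝ}
    (hφ : ContDiffOn ℝ 1 (fun p : ℝ × Plane => φ p.1 p.2) (Ici 0 ×ˢ exteriorDisk))
    {K : Set Plane} (hK : IsCompact K) (hKD : K ⊆ exteriorDisk) {T : ℝ}
    (h0 : ∀ t ∈ Icc 0 T, ∀ x, x ∉ K → β (ω t x) * φ t x = 0) :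
    ContinuousOn (fun t => ∫ x, β (ω t x) * φ t x) (Icc 0 T) ∧ ∀ t ∈ Ioo 0 T,
      Integrable (fun x => β (ω t x) *
        (deriv (fun s => φ s x) t + fderiv ℝ (φ t) x (velocity α (ω t) x))) ∧
      HasDerivAt (fun t => ∫ x, β (ω t x) * φ t x) (∫ x, β (ω t x) *
        (deriv (fun s => φ s x) t + fderiv ℝ (φ t) x (velocity α (ω t) x))) t := by
  have hG : ContDiffOn ℝ 1 (fun p : ℝ × Plane => (fun t x => β (ω t x) * φ t x) p.1 p.2)
      (Ici 0 ×ˢ exteriorDisk) := (hβ.comp_contDiffOn h.solution.contDiffOn).mul hφ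
  refine ⟨continuousOn_integral_of_eq_zero_off_compact hG hK hKD h0, fun t ht => ?_⟩
  obtain ⟨A, B, hAB⟩ := h.exists_bound T
  have key := hasDerivAt_integral_material hG hK hKD h0 ht (hAB t (Ioo_subset_Icc_self ht)) α
  have heq : (fun x => deriv (fun s => β (ω s x) * φ s x) t +
      fderiv ℝ (fun x => β (ω t x) * φ t x) x (velocity α (ω t) x)) = fun x => β (ω t x) *
        (deriv (fun s => φ s x) t + fderiv ℝ (φ t) x (velocity α (ω t) x)) := by
    ext x
    by_cases hx : x ∈ exteriorDisk
    · have ht0 := ht.1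
      have hβd := hβ.differentiable one_ne_zero (ω t x)
      have d1 := (differentiableAt_time_slice h.solution.contDiffOn ht0 hx).hasDerivAt
      have d2 := (differentiableAt_time_slice hφ ht0 hx).hasDerivAt
      have d3 := (differentiableAt_space_slice h.solution.contDiffOn ht0.le hx).hasFDerivAt
      have d4 := (differentiableAt_space_slice hφ ht0.le hx).hasFDerivAt
      have e1 := ((hβd.hasDerivAt.comp t d1).mul d2).deriv
      have e2 := ((hβd.hasDerivAt.comp_hasFDerivAt x d3).mul d4).fderiv
      have e1' : deriv (fun s => β (ω s x) * φ s x) t = deriv β (ω t x) * deriv (fun s => ω s x) t *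
        φ t x + β (ω t x) * deriv (fun s => φ s x) t := e1
      have e2' : fderiv ℝ (fun x => β (ω t x) * φ t x) x = β (ω t x) • fderiv ℝ (φ t) x +
        φ t x • (deriv β (ω t x) • fderiv ℝ (ω t) x) := e2
      have h3 := h.solution.transport t ht0 x hx
      rw [e1', e2']
      simp only [add_apply, smul_apply, smul_eq_mul]
      -- $\beta(\omega)$ is itself transported: the terms in $\beta'(\omega)$ are a multiple of the
      -- transport equation, leaving only the material derivative of $\varphi$.
      linear_combination (deriv β (ω t x) * φ t x) * h3
    · have hxK : x ∉ K := fun hk => hx (hKD hk)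
      have e1 : deriv (fun s => β (ω s x) * φ s x) t = 0 := by
        have : (fun s => β (ω s x) * φ s x) = fun _ => 0 := by
          ext s; rw [h.eq_zero s x hx, hβ0, zero_mul]
        rw [this, deriv_const]
      have e2 : fderiv ℝ (fun x => β (ω t x) * φ t x) x = 0 := by
        have : (fun x => β (ω t x) * φ t x) =ᶠ[nhds x] fun _ => 0 := by
          filter_upwards [hK.isClosed.isOpen_compl.mem_nhds hxK] with y hy
          exact h0 t (Ioo_subset_Icc_self ht) y hy
        rw [this.fderiv_eq, fderiv_const_apply]
      simp [e1, e2, h.eq_zero t x hx, hβ0]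
  simpa only [heq] using key

end

/-! ### The barrier principle. -/

/-- The square of the positive part. -/
noncomputable def posPartSq (r : ℝ) : ℝ := (max r 0) ^ 2

lemma posPartSq_nonneg (r : ℝ) : 0 ≤ posPartSq r := sq_nonneg _

lemma posPartSq_of_nonpos {r : ℝ} (hr : r ≤ 0) : posPartSq r = 0 := by
  simp [posPartSq, hr]

lemma posPartSq_pos {r : ℝ} (hr : 0 < r) : 0 < posPartSq r := by
  rw [posPartSq, max_eq_left hr.le]; positivity

lemma hasDerivAt_posPartSq (r : ℝ) : HasDerivAt posPartSq (2 * max r 0) r := by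
  rcases lt_trichotomy r 0 with h | rfl | h
  · rw [max_eq_right h.le, mul_zero]
    refine (hasDerivAt_const r (0 : ℝ)).congr_of_eventuallyEq ?_
    filter_upwards [Iio_mem_nhds h] with s hs
    exact posPartSq_of_nonpos (le_of_lt hs)
  · rw [max_self, mul_zero]
    have : HasDerivAt (fun s : ℝ => s ^ 2) 0 0 := by simpa using hasDerivAt_pow 2 (0 : ℝ)
    rw [hasDerivAt_iff_isLittleO_nhds_zero] at this ⊢
    refine Asymptotics.IsBigO.trans_isLittleO ?_ this
    refine Asymptotics.IsBigO.of_bound 1 (Filter.Eventually.of_forall fun s => ?_)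
    simp only [posPartSq, zero_add, max_self, smul_zero, sub_zero, norm_pow, one_mul,
      Real.norm_eq_abs, ne_eq, OfNat.ofNat_ne_zero, not_false_eq_true, zero_pow]
    refine pow_le_pow_left₀ (abs_nonneg _) ?_ 2
    rcases le_total s 0 with h | h <;> simp [h]
  · rw [max_eq_left h.le]
    have : HasDerivAt (fun s : ℝ => s ^ 2) (2 * r) r := by simpa using hasDerivAt_pow 2 r
    refine this.congr_of_eventuallyEq ?_
    filter_upwards [Ioi_mem_nhds h] with s hs
    rw [posPartSq, max_eq_left (le_of_lt hs)]

lemma contDiff_posPartSq : ContDiff ℝ 1 posPartSq := by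
  have h : deriv posPartSq = fun r => 2 * max r 0 := funext fun r => (hasDerivAt_posPartSq r).deriv
  rw [contDiff_one_iff_deriv, h]
  exact ⟨fun r => (hasDerivAt_posPartSq r).differentiableAt, by fun_prop⟩

lemma eq_zero_of_deriv_le_mul {E E' : ℝ → ℝ} {T C : ℝ} (hc : ContinuousOn E (Icc 0 T))
    (hd : ∀ t ∈ Ioo 0 T, HasDerivAt E (E' t) t) (hle : ∀ t ∈ Ioo 0 T, E' t ≤ C * E t)
    (h0 : E 0 = 0) (hpos : ∀ t ∈ Icc 0 T, 0 ≤ E t) {t : ℝ} (ht : t ∈ Icc 0 T) : E t = 0 := by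
  have hF : ∀ s ∈ Ioo 0 T, HasDerivAt (fun s => Real.exp (-C * s) * E s)
      (Real.exp (-C * s) * (E' s - C * E s)) s := by
    intro s hs
    have h1 : HasDerivAt (fun s => Real.exp (-C * s)) (Real.exp (-C * s) * (-C)) s := by
      have := ((hasDerivAt_id s).const_mul (-C)).exp
      simpa using this
    exact (h1.mul (hd s hs)).congr_deriv (by ring)
  have hanti : AntitoneOn (fun s => Real.exp (-C * s) * E s) (Icc 0 T) := by
    apply antitoneOn_of_deriv_nonpos (convex_Icc 0 T)
    · exact (by fun_prop : Continuous fun s => Real.exp (-C * s)).continuousOn.mul hc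
    · rw [interior_Icc]
      exact fun s hs => (hF s hs).differentiableAt.differentiableWithinAt
    · rw [interior_Icc]
      intro s hs
      rw [(hF s hs).deriv]
      exact mul_nonpos_of_nonneg_of_nonpos (Real.exp_pos _).le (by linarith [hle s hs])
  have h1 := hanti ⟨le_rfl, ht.1.trans ht.2⟩ ht ht.1
  simp only [h0, mul_zero] at h1
  exact le_antisymm (nonpos_of_mul_nonpos_right h1 (Real.exp_pos _)) (hpos t ht)

lemma eq_zero_of_integral_eq_zero {g : Plane → ℝ} (hg : ContDiff ℝ 1 g) (hc : HasCompactSupport g)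
    (h0 : ∀ x, 0 ≤ g x) (hi : ∫ x, g x = 0) (x : Plane) : g x = 0 := by
  rw [integral_eq_zero_iff_of_nonneg h0 (hg.continuous.integrable_of_hasCompactSupport hc)] at hi
  exact congrFun ((hg.continuous.ae_eq_iff_eq _ continuous_const).1 hi) x

section
variable {α : ℝ} {ω₀ : Plane → ℝ} {ω : ℝ → Plane → ℝ}

/-- The vorticity vanishes where a function decreasing along the flow and initially nonpositive
on its support is positive. -/
lemma IsExtendedSolution.eq_zero_of_barrier (h : IsExtendedSolution α ω₀ ω) {T : ℝ}
    {ζ : ℝ → Plane → ℝ}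
    (hζ : ContDiffOn ℝ 1 (fun p : ℝ × Plane => ζ p.1 p.2) (Ici 0 ×ˢ exteriorDisk))
    {K : Set Plane} (hK : IsCompact K) (hKD : K ⊆ exteriorDisk)
    (hoff : ∀ t ∈ Icc 0 T, ∀ x, x ∉ K → ω t x = 0 ∨ ζ t x ≤ 0)
    (hinit : ∀ x ∈ exteriorDisk, ω₀ x ≠ 0 → ζ 0 x ≤ 0)
    (hdec : ∀ t ∈ Ioo 0 T, ∀ x ∈ exteriorDisk, 0 < ζ t x →
      deriv (fun s => ζ s x) t + fderiv ℝ (ζ t) x (velocity α (ω t) x) ≤ 0)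
    {t : ℝ} (ht : t ∈ Icc 0 T) {x : Plane} (hpos : 0 < ζ t x) :
    ω t x = 0 := by
  have hφ : ContDiffOn ℝ 1 (fun p : ℝ × Plane => (fun t x => posPartSq (ζ t x)) p.1 p.2)
      (Ici 0 ×ˢ exteriorDisk) := contDiff_posPartSq.comp_contDiffOn hζ
  have h0 : ∀ t ∈ Icc 0 T, ∀ x, x ∉ K → ω t x ^ 2 * posPartSq (ζ t x) = 0 := by
    intro t ht x hx
    rcases hoff t ht x hx with h1 | h1
    · simp [h1]
    · simp [posPartSq_of_nonpos h1]
  -- The energy $\int\omega^2(\zeta_+)^2$ starts at zero and is nonincreasing. Squaring makes the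
  -- positive part $C^1$ and removes any need for the sign of $\omega$.
  obtain ⟨hc, hd⟩ := h.hasDerivAt_integral (β := fun r => r ^ 2) (contDiff_id.pow 2) (by simp) hφ
    hK hKD h0
  have hE : ∫ x, ω t x ^ 2 * posPartSq (ζ t x) = 0 := by
    refine eq_zero_of_deriv_le_mul (C := 0) hc (fun s hs => (hd s hs).2) (fun s hs => ?_) ?_
      (fun s hs => integral_nonneg fun x => mul_nonneg (sq_nonneg _) (posPartSq_nonneg _)) ht
    · rw [zero_mul]
      refine integral_nonpos fun x => ?_
      by_cases hx : x ∈ exteriorDisk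
      · refine mul_nonpos_of_nonneg_of_nonpos (sq_nonneg _) ?_
        have e1 := ((hasDerivAt_posPartSq (ζ s x)).comp s
          (differentiableAt_time_slice hζ hs.1 hx).hasDerivAt).deriv
        have e2 := ((hasDerivAt_posPartSq (ζ s x)).comp_hasFDerivAt x
          (differentiableAt_space_slice hζ hs.1.le hx).hasFDerivAt).fderiv
        have e1' : deriv (fun s => posPartSq (ζ s x)) s =
          2 * max (ζ s x) 0 * deriv (fun s => ζ s x) s := e1
        have e2' : fderiv ℝ (fun x => posPartSq (ζ s x)) x =
          (2 * max (ζ s x) 0) • fderiv ℝ (ζ s) x := e2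
        rw [e1', e2', smul_apply, smul_eq_mul, ← mul_add]
        rcases le_or_gt (ζ s x) 0 with hz | hz
        · simp [hz]
        · exact mul_nonpos_of_nonneg_of_nonpos (by positivity) (hdec s hs x hx hz)
      · simp [h.eq_zero s x hx]
    · have : ∀ x, ω 0 x ^ 2 * posPartSq (ζ 0 x) = 0 := by
        intro x
        by_cases hx : x ∈ exteriorDisk
        · by_cases hw : ω₀ x = 0
          · simp [h.solution.initial x hx, hw]
          · simp [posPartSq_of_nonpos (hinit x hx hw)]
        · simp [h.eq_zero 0 x hx]
      simp [this]
  have hG : ContDiffOn ℝ 1 (fun p : ℝ × Plane => (fun t x => ω t x ^ 2 * posPartSq (ζ t x)) p.1 p.2)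
      (Ici 0 ×ˢ exteriorDisk) := (h.solution.contDiffOn.pow 2).mul hφ
  obtain ⟨g1, g2, -⟩ := contDiff_of_contDiffOn_of_eq_zero hK hKD
    (contDiffOn_space_slice (G := fun t x => ω t x ^ 2 * posPartSq (ζ t x)) hG ht.1) (h0 t ht)
  have := eq_zero_of_integral_eq_zero g1 g2
    (fun x => mul_nonneg (sq_nonneg _) (posPartSq_nonneg _)) hE x
  simpa [(posPartSq_pos hpos).ne'] using this

/-! ### Compact support on bounded time intervals. -/

/-- A radial coordinate on the exterior domain whose material derivative is bounded. -/
noncomputable def radialCoord (x : Plane) : ℝ := Real.arsinh (Real.log (‖x‖ ^ 2 - 1))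

lemma norm_sq_sub_one_pos {x : Plane} (hx : x ∈ exteriorDisk) : 0 < ‖x‖ ^ 2 - 1 := by
  have : 1 < ‖x‖ := hx
  nlinarith

lemma contDiffOn_radialCoord : ContDiffOn ℝ 1 radialCoord exteriorDisk := by
  refine Real.contDiff_arsinh.comp_contDiffOn (ContDiffOn.log ?_ fun x hx =>
    (norm_sq_sub_one_pos hx).ne')
  exact ((contDiff_norm_sq ℝ).sub contDiff_const).contDiffOn

lemma hasFDerivAt_norm_sq (x : Plane) :
    HasFDerivAt (fun x : Plane => ‖x‖ ^ 2) (2 • (innerSL ℝ x)) x :=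
  (hasStrictFDerivAt_norm_sq x).hasFDerivAt

lemma hasFDerivAt_radialCoord {x : Plane} (hx : x ∈ exteriorDisk) :
    HasFDerivAt radialCoord ((√(1 + Real.log (‖x‖ ^ 2 - 1) ^ 2))⁻¹ • (‖x‖ ^ 2 - 1)⁻¹ •
      (2 • (innerSL ℝ x))) x := by
  have h1 : HasFDerivAt (fun x : Plane => ‖x‖ ^ 2 - 1) (2 • (innerSL ℝ x)) x :=
    (hasFDerivAt_norm_sq x).sub_const 1
  exact (Real.hasDerivAt_arsinh _).comp_hasFDerivAt x (h1.log (norm_sq_sub_one_pos hx).ne')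

/-- The derivative of $\operatorname{arsinh}(\log\varepsilon)$ in $\varepsilon=|x|^2-1$ is
$1/(\varepsilon\sqrt{1+\log^2\varepsilon})$, exactly the reciprocal of the modulus bounding the
radial velocity. -/
lemma abs_fderiv_radialCoord_velocity_le {w : Plane → ℝ} {A B : ℝ} (h : IsBoundedVorticity w A B)
    (α : ℝ) {x : Plane} (hx : x ∈ exteriorDisk) :
    |fderiv ℝ radialCoord x (velocity α w x)| ≤ 100 * (A + B) := by
  have h1 := h.abs_integral_radialKernel_mul_le_log hx
  have hε := norm_sq_sub_one_pos hx
  have hA := h.nonneg_left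
  have hB := h.nonneg_right
  have hs : 0 < √(1 + Real.log (‖x‖ ^ 2 - 1) ^ 2) := Real.sqrt_pos.2 (by positivity)
  rw [(hasFDerivAt_radialCoord hx).fderiv]
  simp only [smul_apply, innerSL_apply_apply, h.inner_velocity α hx, smul_eq_mul, nsmul_eq_mul]
  set I := ∫ y, radialKernel x y * w y
  set ε := ‖x‖ ^ 2 - 1
  set s := √(1 + Real.log ε ^ 2)
  have e : s⁻¹ * (ε⁻¹ * ((2 : ℕ) * ((2 * Real.pi)⁻¹ * I))) = Real.pi⁻¹ * ((ε * s)⁻¹ * I) := by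
    push_cast
    field_simp
  rw [e, abs_mul, abs_mul, abs_of_pos (inv_pos.2 Real.pi_pos),
    abs_of_pos (inv_pos.2 (mul_pos hε hs))]
  have h2 : (ε * s)⁻¹ * |I| ≤ 100 * (A + B) := by
    rw [inv_mul_le_iff₀ (mul_pos hε hs)]; linarith
  have h3 : Real.pi⁻¹ ≤ 1 := inv_le_one_of_one_le₀ (by linarith [Real.pi_gt_three])
  calc _ ≤ 1 * (100 * (A + B)) := by gcongr
    _ = _ := one_mul _

/-- The closed annulus `a ≤ |x|² ≤ b`. -/
def closedAnnulus (a b : ℝ) : Set Plane := {x | a ≤ ‖x‖ ^ 2 ∧ ‖x‖ ^ 2 ≤ b}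

lemma isCompact_closedAnnulus (a b : ℝ) : IsCompact (closedAnnulus a b) := by
  apply Metric.isCompact_of_isClosed_isBounded
  · have h1 : Continuous fun x : Plane => ‖x‖ ^ 2 := by fun_prop
    exact (isClosed_le continuous_const h1).inter (isClosed_le h1 continuous_const)
  · refine (Metric.isBounded_closedBall (x := 0) (r := √b)).subset fun x hx => ?_
    rw [mem_closedBall_zero_iff]
    exact Real.le_sqrt_of_sq_le hx.2

lemma closedAnnulus_subset {a b : ℝ} (ha : 1 < a) : closedAnnulus a b ⊆ exteriorDisk := by
  intro x hx
  have h : (1 : ℝ) ^ 2 < ‖x‖ ^ 2 := by rw [one_pow]; exact ha.trans_le hx.1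
  exact lt_of_pow_lt_pow_left₀ 2 (norm_nonneg _) h

lemma mem_closedAnnulus_of_abs_radialCoord_le {x : Plane} (hx : x ∈ exteriorDisk) {R : ℝ}
    (hR : |radialCoord x| ≤ R) :
    x ∈ closedAnnulus (1 + Real.exp (-Real.sinh R)) (1 + Real.exp (Real.sinh R)) := by
  have hε := norm_sq_sub_one_pos hx
  obtain ⟨h1, h2⟩ := abs_le.1 hR
  have h3 : Real.log (‖x‖ ^ 2 - 1) ≤ Real.sinh R := by
    rw [← Real.arsinh_le_arsinh, Real.arsinh_sinh]; exact h2
  have h4 : -Real.sinh R ≤ Real.log (‖x‖ ^ 2 - 1) := by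
    rw [← Real.arsinh_le_arsinh, ← Real.sinh_neg, Real.arsinh_sinh]; exact h1
  rw [Real.log_le_iff_le_exp hε] at h3
  rw [Real.le_log_iff_exp_le hε] at h4
  constructor <;> linarith

/-- On bounded time intervals the vorticity stays in a compact subset of the exterior domain. -/
lemma IsExtendedSolution.exists_closedAnnulus (h : IsExtendedSolution α ω₀ ω)
    (hcompact : HasCompactSupport ω₀) (hsupp : tsupport ω₀ ⊆ exteriorDisk) (T : ℝ) :
    ∃ a b : ℝ, 1 < a ∧ ∀ t ∈ Icc 0 T, ∀ x, x ∉ closedAnnulus a b → ω t x = 0 := by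
  rcases lt_or_ge T 0 with hT | hT
  · exact ⟨2, 2, by norm_num, fun t ht => absurd (ht.1.trans ht.2) hT.not_ge⟩
  obtain ⟨A, B, hAB⟩ := h.exists_bound T
  have hA := (hAB 0 ⟨le_rfl, hT⟩).nonneg_left
  have hB := (hAB 0 ⟨le_rfl, hT⟩).nonneg_right
  obtain ⟨R₀, hR₀⟩ := hcompact.isCompact.exists_bound_of_continuousOn
    (contDiffOn_radialCoord.continuousOn.mono hsupp)
  set C := 100 * (A + B) with hC
  have hC0 : 0 ≤ C := by positivity
  -- The margin `2` exceeds the value $N(x)=1$ of the smoothed distance at its centre, so the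
  -- barrier is still positive at `x` up to time `T`.
  set κ := C * T + 2 with hκ
  refine ⟨1 + Real.exp (-Real.sinh (R₀ + κ)), 1 + Real.exp (Real.sinh (R₀ + κ)),
    by linarith [Real.exp_pos (-Real.sinh (R₀ + κ))], fun t ht x hx => ?_⟩
  by_cases hxD : x ∈ exteriorDisk
  swap
  · exact h.eq_zero t x hxD
  have hxR : R₀ + κ < |radialCoord x| := by
    by_contra hle
    exact hx (mem_closedAnnulus_of_abs_radialCoord_le hxD (not_lt.1 hle))
  -- A smooth substitute for $|\mathrm{radialCoord}(y)-\mathrm{radialCoord}(x)|$. The barrier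
  -- $\kappa-Cs-N$ is a backward cone around `x`: it is positive only in a compact region, so the
  -- solution needs no prior decay there, and at time 0 it misses the support of the datum.
  set N : Plane → ℝ := fun y => √(1 + (radialCoord y - radialCoord x) ^ 2) with hN
  have hNabs : ∀ y, |radialCoord y - radialCoord x| ≤ N y := fun y =>
    Real.abs_le_sqrt (by linarith)
  have hNd : ∀ y ∈ exteriorDisk, HasFDerivAt N ((1 / (2 * N y)) •
      ((2 * (radialCoord y - radialCoord x)) • fderiv ℝ radialCoord y)) y := by
    intro y hy
    have h1 := ((hasFDerivAt_radialCoord hy).differentiableAt.hasFDerivAt.sub_const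
      (radialCoord x)).pow 2
    have h2 := (h1.const_add 1).sqrt (by positivity)
    simpa using h2
  set R := |radialCoord x| + κ with hR
  refine h.eq_zero_of_barrier (T := T) (ζ := fun t y => κ - C * t - N y) ?_
    (isCompact_closedAnnulus (1 + Real.exp (-Real.sinh R)) (1 + Real.exp (Real.sinh R)))
    (closedAnnulus_subset (by linarith [Real.exp_pos (-Real.sinh R)])) ?_ ?_ ?_ ht ?_
  · have h1 : ContDiffOn ℝ 1 N exteriorDisk := by
      refine ContDiffOn.sqrt ?_ fun y _ => by positivity
      exact contDiffOn_const.add ((contDiffOn_radialCoord.sub contDiffOn_const).pow 2)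
    refine ContDiffOn.sub (by fun_prop) ?_
    exact h1.comp contDiffOn_snd fun p hp => hp.2
  · intro s hs y hy
    by_cases hyD : y ∈ exteriorDisk
    · right
      have h1 : R < |radialCoord y| := by
        by_contra hle
        exact hy (mem_closedAnnulus_of_abs_radialCoord_le hyD (not_lt.1 hle))
      have h2 := hNabs y
      have h3 := abs_sub_abs_le_abs_sub (radialCoord y) (radialCoord x)
      have := mul_nonneg hC0 hs.1
      linarith
    · exact Or.inl (h.eq_zero s y hyD)
  · intro y hy hne
    have h1 := hR₀ y (subset_tsupport _ hne)
    rw [Real.norm_eq_abs] at h1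
    have h2 := hNabs y
    have h3 := abs_sub_abs_le_abs_sub (radialCoord x) (radialCoord y)
    rw [abs_sub_comm] at h3
    linarith
  · intro s hs y hy _
    have e1 : deriv (fun s => κ - C * s - N y) s = -C := by
      have : HasDerivAt (fun s => κ - C * s - N y) (0 - C * 1 - 0) s :=
        ((hasDerivAt_const s κ).sub ((hasDerivAt_id s).const_mul C)).sub (hasDerivAt_const s _)
      rw [this.deriv]; ring
    have e2 : fderiv ℝ (fun y => κ - C * s - N y) y = -((1 / (2 * N y)) •
      ((2 * (radialCoord y - radialCoord x)) • fderiv ℝ radialCoord y)) :=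
      ((hNd y hy).const_sub (κ - C * s)).fderiv
    rw [e1, e2]
    have h1 := abs_fderiv_radialCoord_velocity_le (hAB s (Ioo_subset_Icc_self hs)) α hy
    have hN0 : 0 < N y := Real.sqrt_pos.2 (by positivity)
    simp only [neg_apply, smul_apply, smul_eq_mul]
    set d := fderiv ℝ radialCoord y (velocity α (ω s) y)
    have h2 : |1 / (2 * N y) * (2 * (radialCoord y - radialCoord x) * d)| ≤ C := by
      have e3 : 1 / (2 * N y) * (2 * (radialCoord y - radialCoord x) * d) =
        (radialCoord y - radialCoord x) / N y * d := by field_simp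
      rw [e3, abs_mul, abs_div, abs_of_pos hN0]
      calc _ ≤ 1 * C := by
            gcongr
            exact div_le_one_of_le₀ (hNabs y) hN0.le
        _ = C := one_mul C
    linarith [(abs_le.1 h2).1]
  · have : N x = 1 := by simp [hN]
    have h1 : C * t ≤ C * T := mul_le_mul_of_nonneg_left ht.2 hC0
    simp only [this]
    linarith

end

/-! ### Conservation of mass, sign and upper bound. -/

/-- The initial data considered: even, nonnegative, `C¹` and compactly supported in the exterior
domain. -/
structure IsEvenDatum (ω₀ : Plane → ℝ) : Prop where
  contDiff : ContDiff ℝ 1 ω₀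
  hasCompactSupport : HasCompactSupport ω₀
  tsupport_subset : tsupport ω₀ ⊆ exteriorDisk
  nonneg : ∀ x, 0 ≤ ω₀ x
  even : ∀ x, ω₀ (-x) = ω₀ x

section
variable {α : ℝ} {ω₀ : Plane → ℝ} {ω : ℝ → Plane → ℝ}

lemma IsExtendedSolution.initial_eq (h : IsExtendedSolution α ω₀ ω) (h₀ : IsEvenDatum ω₀) :
    ω 0 = ω₀ := by
  ext x
  by_cases hx : x ∈ exteriorDisk
  · exact h.solution.initial x hx
  · rw [h.eq_zero 0 x hx]
    by_contra hne
    exact hx (h₀.tsupport_subset (subset_tsupport _ (Ne.symm hne)))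

lemma IsExtendedSolution.contDiff_hasCompactSupport (h : IsExtendedSolution α ω₀ ω)
    (h₀ : IsEvenDatum ω₀) {t : ℝ} (ht : 0 ≤ t) :
    ContDiff ℝ 1 (ω t) ∧ HasCompactSupport (ω t) ∧ tsupport (ω t) ⊆ exteriorDisk := by
  obtain ⟨a, b, ha, hab⟩ := h.exists_closedAnnulus h₀.hasCompactSupport h₀.tsupport_subset t
  exact contDiff_of_contDiffOn_of_eq_zero (isCompact_closedAnnulus a b) (closedAnnulus_subset ha)
    (contDiffOn_space_slice h.solution.contDiffOn ht) (hab t ⟨ht, le_rfl⟩)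

/-- Evolution of the integral of a function of the vorticity against a test function that need not
have compact support. -/
lemma IsExtendedSolution.hasDerivAt_integral_mul (h : IsExtendedSolution α ω₀ ω)
    (h₀ : IsEvenDatum ω₀) {β : ℝ → ℝ} (hβ : ContDiff ℝ 1 β) (hβ0 : β 0 = 0)
    {φ : ℝ → Plane → ℝ}
    (hφ : ContDiffOn ℝ 1 (fun p : ℝ × Plane => φ p.1 p.2) (Ici 0 ×ˢ exteriorDisk)) (T : ℝ) :
    ContinuousOn (fun t => ∫ x, β (ω t x) * φ t x) (Icc 0 T) ∧ ∀ t ∈ Ioo 0 T,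
      HasDerivAt (fun t => ∫ x, β (ω t x) * φ t x) (∫ x, β (ω t x) *
        (deriv (fun s => φ s x) t + fderiv ℝ (φ t) x (velocity α (ω t) x))) t := by
  obtain ⟨a, b, ha, hab⟩ := h.exists_closedAnnulus h₀.hasCompactSupport h₀.tsupport_subset T
  obtain ⟨h1, h2⟩ := h.hasDerivAt_integral hβ hβ0 hφ (isCompact_closedAnnulus a b)
    (closedAnnulus_subset ha) (T := T) fun t ht x hx => by rw [hab t ht x hx, hβ0, zero_mul]
  exact ⟨h1, fun t ht => (h2 t ht).2⟩

/-- The derivative is only given for positive times; at `0` the right derivative is recovered as a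
limit. -/
lemma eq_initial_of_deriv_eq_zero {E : ℝ → ℝ} (hc : ∀ T, ContinuousOn E (Icc 0 T))
    (hd : ∀ t, 0 < t → HasDerivAt E 0 t) {t : ℝ} (ht : 0 ≤ t) : E t = E 0 := by
  refine constant_of_has_deriv_right_zero (hc t) (fun s hs => ?_) t ⟨ht, le_rfl⟩
  rcases hs.1.eq_or_lt with rfl | hs0
  · refine hasDerivWithinAt_Ici_of_tendsto_deriv (s := Ioo 0 t) ?_ ?_ ?_ ?_
    · exact fun r hr => (hd r hr.1).differentiableAt.differentiableWithinAt
    · exact ((hc t) 0 ⟨le_rfl, ht⟩).mono Ioo_subset_Icc_self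
    · exact Ioo_mem_nhdsGT hs.2
    · refine tendsto_const_nhds.congr' ?_
      filter_upwards [self_mem_nhdsWithin] with r hr
      exact ((hd r hr).deriv).symm
  · exact (hd s hs0).hasDerivWithinAt

lemma IsExtendedSolution.integral_comp_eq (h : IsExtendedSolution α ω₀ ω) (h₀ : IsEvenDatum ω₀)
    {β : ℝ → ℝ} (hβ : ContDiff ℝ 1 β) (hβ0 : β 0 = 0) {t : ℝ} (ht : 0 ≤ t) :
    ∫ x, β (ω t x) = ∫ x, β (ω₀ x) := by
  have key := h.hasDerivAt_integral_mul h₀ hβ hβ0 (φ := fun _ _ => 1) contDiffOn_const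
  simp only [mul_one, deriv_const, fderiv_fun_const, Pi.zero_apply, zero_apply, add_zero, mul_zero,
    integral_zero] at key
  have := eq_initial_of_deriv_eq_zero (fun T => (key T).1)
    (fun t ht => (key (t + 1)).2 t ⟨ht, by linarith⟩) ht
  rw [this, h.initial_eq h₀]

/-- Conservation of $\int\beta(\omega)$ becomes pointwise since $\beta\ge0$ and $\omega$ is
continuous. The choices $\beta(r)=(-r)_+^2$ and $(r-B)_+^2$ give the lower and upper bounds on
$\omega$. -/
lemma IsExtendedSolution.comp_eq_zero (h : IsExtendedSolution α ω₀ ω) (h₀ : IsEvenDatum ω₀)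
    {β : ℝ → ℝ} (hβ : ContDiff ℝ 1 β) (hβ0 : β 0 = 0) (hpos : ∀ r, 0 ≤ β r)
    (hinit : ∀ x, β (ω₀ x) = 0) {t : ℝ} (ht : 0 ≤ t) (x : Plane) : β (ω t x) = 0 := by
  obtain ⟨g1, g2, -⟩ := h.contDiff_hasCompactSupport h₀ ht
  refine eq_zero_of_integral_eq_zero (g := fun x => β (ω t x)) (hβ.comp g1)
    (g2.comp_left (g := β) hβ0) (fun x => hpos _) ?_ x
  rw [h.integral_comp_eq h₀ hβ hβ0 ht]
  simp [hinit]

lemma IsExtendedSolution.nonneg (h : IsExtendedSolution α ω₀ ω) (h₀ : IsEvenDatum ω₀) {t : ℝ}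
    (ht : 0 ≤ t) (x : Plane) : 0 ≤ ω t x := by
  by_contra hx
  have := h.comp_eq_zero h₀ (β := fun r => posPartSq (-r)) (contDiff_posPartSq.comp contDiff_neg)
    (posPartSq_of_nonpos (by simp)) (fun r => posPartSq_nonneg _)
    (fun x => posPartSq_of_nonpos (by simpa using h₀.nonneg x)) ht x
  exact (posPartSq_pos (by linarith : 0 < -ω t x)).ne' this

lemma IsExtendedSolution.le_of_initial_le (h : IsExtendedSolution α ω₀ ω) (h₀ : IsEvenDatum ω₀)
    {B : ℝ} (hB : ∀ x, ω₀ x ≤ B) {t : ℝ} (ht : 0 ≤ t) (x : Plane) : ω t x ≤ B := by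
  by_contra hx
  have hB0 : 0 ≤ B := (h₀.nonneg 0).trans (hB 0)
  have := h.comp_eq_zero h₀ (β := fun r => posPartSq (r - B))
    (contDiff_posPartSq.comp (contDiff_id.sub contDiff_const))
    (posPartSq_of_nonpos (by simpa using hB0)) (fun r => posPartSq_nonneg _)
    (fun x => posPartSq_of_nonpos (by simpa using hB x)) ht x
  exact (posPartSq_pos (by linarith : 0 < ω t x - B)).ne' this

lemma IsExtendedSolution.integral_eq (h : IsExtendedSolution α ω₀ ω) (h₀ : IsEvenDatum ω₀)
    {t : ℝ} (ht : 0 ≤ t) : ∫ x, ω t x = ∫ x, ω₀ x :=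
  h.integral_comp_eq h₀ (β := fun r => r) contDiff_id rfl ht

/-- Bounds on the vorticity uniform in time and depending on the initial datum only. -/
lemma IsExtendedSolution.isBoundedVorticity (h : IsExtendedSolution α ω₀ ω) (h₀ : IsEvenDatum ω₀)
    {B : ℝ} (hB : ∀ x, ω₀ x ≤ B) {t : ℝ} (ht : 0 ≤ t) :
    IsBoundedVorticity (ω t) (∫ x, ω₀ x) B := by
  obtain ⟨g1, g2, -⟩ := h.contDiff_hasCompactSupport h₀ ht
  have hpos := h.nonneg h₀ ht
  refine ⟨h.eq_zero t, g1.continuous.integrable_of_hasCompactSupport g2, ?_, fun x => ?_⟩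
  · simp only [abs_of_nonneg (hpos _)]
    exact (h.integral_eq h₀ ht).le
  · rw [abs_of_nonneg (hpos x)]
    exact h.le_of_initial_le h₀ hB ht x

end

/-! ### A quadratic estimate for the singular kernel. -/

section
variable {f g w : Plane → ℝ} {A B A' B' : ℝ}

lemma IsBoundedVorticity.integrable_prod_inv_norm (hf : IsBoundedVorticity f A B)
    (hg : IsBoundedVorticity g A' B') :
    Integrable (fun p : Plane × Plane => |f p.1| * |g p.2| * ‖p.1 - p.2‖⁻¹)
      (volume.prod volume) := by
  have hB := hf.nonneg_right
  have i1 : Integrable (fun p : Plane × Plane => |g p.2| * nearKernel 1 (p.1 - p.2))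
      (volume.prod volume) :=
    hg.integrable.abs.convolution_integrand (ContinuousLinearMap.mul ℝ ℝ) (integrable_nearKernel 1)
  have i2 : Integrable (fun p : Plane × Plane => |f p.1| * |g p.2|) (volume.prod volume) :=
    hf.integrable.abs.mul_prod hg.integrable.abs
  refine ((i1.const_mul B).add i2).mono' ?_ (Filter.Eventually.of_forall fun p => ?_)
  · exact i2.aestronglyMeasurable.mul
      (by fun_prop : Measurable fun p : Plane × Plane => ‖p.1 - p.2‖⁻¹).aestronglyMeasurable
  · rw [Real.norm_of_nonneg (by positivity)]
    have h1 := inv_norm_le_nearKernel one_pos (p.1 - p.2)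
    have h2 := nearKernel_nonneg 1 (p.1 - p.2)
    have h3 := hf.abs_le p.1
    rw [inv_one] at h1
    calc _ ≤ |f p.1| * |g p.2| * (nearKernel 1 (p.1 - p.2) + 1) := by gcongr
      _ = |f p.1| * (|g p.2| * nearKernel 1 (p.1 - p.2)) + |f p.1| * |g p.2| := by ring
      _ ≤ B * (|g p.2| * nearKernel 1 (p.1 - p.2)) + |f p.1| * |g p.2| := by gcongr

lemma isBoundedVorticity_indicator {K : Set Plane} (hK : IsCompact K) (hKD : K ⊆ exteriorDisk) :
    IsBoundedVorticity (K.indicator fun _ => 1) (volume.real K) 1 := by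
  have hi : Integrable (K.indicator fun _ => (1 : ℝ)) :=
    (integrable_indicator_iff hK.measurableSet).2 (integrableOn_const hK.measure_lt_top.ne)
  have habs : ∀ x, |K.indicator (fun _ => (1 : ℝ)) x| = K.indicator (fun _ => (1 : ℝ)) x := fun x =>
    abs_of_nonneg (indicator_nonneg (fun _ _ => zero_le_one) x)
  refine ⟨fun x hx => indicator_of_notMem (fun h => hx (hKD h)) _, hi, ?_, fun x => ?_⟩
  · simp only [habs]
    rw [integral_indicator hK.measurableSet]
    simp
  · rw [habs]
    exact indicator_apply_le' (fun _ => le_rfl) fun _ => zero_le_one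

lemma IsBoundedVorticity.sq (h : IsBoundedVorticity w A B) :
    IsBoundedVorticity (fun x => w x ^ 2) (B * A) (B ^ 2) := by
  have hB := h.nonneg_right
  have hle : ∀ x, |w x ^ 2| ≤ B * |w x| := fun x => by
    rw [abs_pow, pow_two]
    exact mul_le_mul_of_nonneg_right (h.abs_le x) (abs_nonneg _)
  have hi : Integrable fun x => w x ^ 2 := (h.integrable.abs.const_mul B).mono'
    (h.integrable.aestronglyMeasurable.pow 2) (Filter.Eventually.of_forall hle)
  refine ⟨fun x hx => by simp [h.eq_zero x hx], hi, ?_, fun x => ?_⟩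
  · calc _ ≤ ∫ x, B * |w x| := integral_mono hi.abs (h.integrable.abs.const_mul B) hle
      _ ≤ _ := by
        rw [integral_const_mul]
        gcongr
        exact h.integral_abs_le
  · rw [abs_pow]
    gcongr
    exact h.abs_le x

/-- Schur's test for the kernel `1/|x-y| + c` on a compact set. -/
lemma IsBoundedVorticity.integral_mul_integral_le (h : IsBoundedVorticity w A B) {K : Set Plane}
    (hK : IsCompact K) (hKD : K ⊆ exteriorDisk) (h0 : ∀ x, x ∉ K → w x = 0) {c : ℝ} (hc : 0 ≤ c) :
    Integrable (fun x => |w x| * ∫ y, |w y| * (‖x - y‖⁻¹ + c)) ∧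
    ∫ x, |w x| * ∫ y, |w y| * (‖x - y‖⁻¹ + c) ≤
      (2 * Real.pi + volume.real K + c * volume.real K) * ∫ x, w x ^ 2 := by
  have h1 := isBoundedVorticity_indicator hK hKD
  set χ : Plane → ℝ := K.indicator fun _ => 1 with hχ
  have hχ0 : ∀ x, 0 ≤ χ x := fun x => indicator_nonneg (fun _ _ => zero_le_one) x
  have hw : ∀ x, |w x| = |w x| * χ x := by
    intro x
    by_cases hx : x ∈ K
    · simp [hχ, hx]
    · simp [h0 x hx]
  have iF : ∀ {f g : Plane → ℝ} {A B A' B' : ℝ}, IsBoundedVorticity f A B →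
      IsBoundedVorticity g A' B' → Integrable (fun p : Plane × Plane =>
        |f p.1| * |g p.2| * (‖p.1 - p.2‖⁻¹ + c)) (volume.prod volume) := by
    intro f g A B A' B' hf hg
    have := (hf.integrable_prod_inv_norm hg).add
      ((hf.integrable.abs.mul_prod hg.integrable.abs).mul_const c)
    refine this.congr (Filter.Eventually.of_forall fun p => ?_)
    simp only [Pi.add_apply]
    ring
  have i0 := iF h h
  have i1 := iF h.sq h1
  have i2 := iF h1 h.sq
  have e0 : ∀ x, |w x| * ∫ y, |w y| * (‖x - y‖⁻¹ + c) =
      ∫ y, |w x| * |w y| * (‖x - y‖⁻¹ + c) := by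
    intro x
    rw [← integral_const_mul]
    simp only [mul_assoc]
  simp only [e0]
  refine ⟨i0.integral_prod_left, ?_⟩
  rw [integral_integral (f := fun x y => |w x| * |w y| * (‖x - y‖⁻¹ + c)) i0]
  have hswap : ∫ p : Plane × Plane, |χ p.1| * |w p.2 ^ 2| * (‖p.1 - p.2‖⁻¹ + c)
        ∂(volume.prod volume) = ∫ p : Plane × Plane, |w p.1 ^ 2| * |χ p.2| * (‖p.1 - p.2‖⁻¹ + c)
        ∂(volume.prod volume) := by
    rw [← integral_prod_swap]
    congr 1
    ext p
    simp only [Prod.fst_swap, Prod.snd_swap]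
    rw [norm_sub_rev]
    ring
  have hmain : ∫ p : Plane × Plane, |w p.1 ^ 2| * |χ p.2| * (‖p.1 - p.2‖⁻¹ + c)
        ∂(volume.prod volume) ≤
      (2 * Real.pi + volume.real K + c * volume.real K) * ∫ x, w x ^ 2 := by
    rw [integral_prod _ i1, ← integral_const_mul]
    refine integral_mono i1.integral_prod_left (h.sq.integrable.const_mul _) fun x => ?_
    have j1 := h1.integral_inv_norm_mul_le x one_pos
    have j2 := h1.integral_abs_le
    have e1 : ∀ y, |w x ^ 2| * |χ y| * (‖x - y‖⁻¹ + c) =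
        w x ^ 2 * (‖x - y‖⁻¹ * |χ y| + c * |χ y|) := fun y => by
      rw [abs_of_nonneg (sq_nonneg (w x))]; ring
    simp only [e1]
    rw [integral_const_mul, integral_add (h1.integrable_inv_norm_mul x)
      (h1.integrable.abs.const_mul c), integral_const_mul, mul_comm]
    gcongr
    linarith
  calc _ ≤ ∫ p : Plane × Plane, (1 / 2 * (|w p.1 ^ 2| * |χ p.2| * (‖p.1 - p.2‖⁻¹ + c)) +
        1 / 2 * (|χ p.1| * |w p.2 ^ 2| * (‖p.1 - p.2‖⁻¹ + c))) ∂(volume.prod volume) := by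
        refine integral_mono i0 ((i1.const_mul _).add (i2.const_mul _)) fun p => ?_
        have hk : 0 ≤ ‖p.1 - p.2‖⁻¹ + c := by positivity
        -- Young's inequality with the indicator of `K` as second factor: each half then pairs $w^2$
        -- with the potential of an indicator, which is bounded.
        have hle : |w p.1| * |w p.2| ≤
            1 / 2 * (|w p.1 ^ 2| * |χ p.2|) + 1 / 2 * (|χ p.1| * |w p.2 ^ 2|) := by
          simp only [abs_pow, abs_of_nonneg (hχ0 _)]
          by_cases hx : p.1 ∈ K
          · by_cases hy : p.2 ∈ K
            · simp only [hχ, indicator_of_mem hx, indicator_of_mem hy]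
              nlinarith [sq_nonneg (|w p.1| - |w p.2|)]
            · rw [h0 _ hy, abs_zero, mul_zero]
              have := hχ0 p.1
              have := hχ0 p.2
              positivity
          · rw [h0 _ hx, abs_zero, zero_mul]
            have := hχ0 p.1
            have := hχ0 p.2
            positivity
        have := mul_le_mul_of_nonneg_right hle hk
        dsimp only
        linarith
    _ ≤ _ := by
        rw [integral_add (i1.const_mul _) (i2.const_mul _), integral_const_mul,
          integral_const_mul, hswap]
        linarith

end

/-! ### Persistence of evenness. -/

lemma inversionPt_neg (y : Plane) : inversionPt (-y) = -inversionPt y := by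
  simp [inversionPt]

lemma biotSavartKernel_neg_neg (x y : Plane) :
    biotSavartKernel (-x) (-y) = -biotSavartKernel x y := by
  have h1 : ∀ z : Plane, -x - -z = -(x - z) := fun z => by abel
  simp only [biotSavartKernel, inversionPt_neg, h1, norm_neg, perp_neg, smul_neg]
  abel

section
variable {w : Plane → ℝ} {A B : ℝ}

/-- The kernel is odd under joint reflection and the harmonic field is odd, so `α` cancels and the
defect of oddness of the velocity is linear in the odd part of `w`. -/
lemma IsBoundedVorticity.velocity_add_velocity_neg (h : IsBoundedVorticity w A B) (α : ℝ)
    {x : Plane} (hx : 1 < ‖x‖) : velocity α w x + velocity α w (-x) =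
      (2 * Real.pi)⁻¹ • ∫ y, (w y - w (-y)) • biotSavartKernel x y := by
  have hx' : 1 < ‖-x‖ := by simpa
  have i1 := h.integrable_biotSavartKernel hx
  have i2 := (h.integrable_biotSavartKernel hx').comp_neg
  have e : ∀ y, w (-y) • biotSavartKernel (-x) (-y) = -(w (-y) • biotSavartKernel x y) := fun y => by
    rw [biotSavartKernel_neg_neg, smul_neg]
  simp only [e] at i2
  have i3 : Integrable fun y => w (-y) • biotSavartKernel x y := by simpa using i2.neg
  rw [h.velocity_eq, h.velocity_eq, ← smul_add, norm_neg, perp_neg, smul_neg,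
    ← integral_neg_eq_self (fun y => w y • biotSavartKernel (-x) y)]
  simp only [e, sub_smul]
  rw [integral_sub i1 i3, integral_neg]
  congr 1
  abel

lemma IsBoundedVorticity.sub_comp_neg (h : IsBoundedVorticity w A B) :
    IsBoundedVorticity (fun x => w x - w (-x)) (A + A) (B + B) := by
  have hn : ∫ x, |w (-x)| = ∫ x, |w x| := integral_neg_eq_self (fun x => |w x|) volume
  refine ⟨fun x hx => ?_, h.integrable.sub h.integrable.comp_neg, ?_, fun x => ?_⟩
  · rw [h.eq_zero x hx, h.eq_zero (-x) (by simpa [exteriorDisk] using hx), sub_zero]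
  · calc _ ≤ ∫ x, (|w x| + |w (-x)|) := by
          refine integral_mono (h.integrable.sub h.integrable.comp_neg).abs
            (h.integrable.abs.add h.integrable.comp_neg.abs) fun x => abs_sub _ _
      _ ≤ _ := by
          rw [integral_add h.integrable.abs h.integrable.comp_neg.abs, hn]
          linarith [h.integral_abs_le]
  · exact (abs_sub _ _).trans (add_le_add (h.abs_le x) (h.abs_le (-x)))

lemma IsBoundedVorticity.norm_velocity_add_velocity_neg_le (h : IsBoundedVorticity w A B) (α : ℝ)
    {x : Plane} {δ : ℝ} (hδ : 0 < δ) (hx : 1 + δ ≤ ‖x‖) :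
    ‖velocity α w x + velocity α w (-x)‖ ≤ ∫ y, |w y - w (-y)| * (‖x - y‖⁻¹ + δ⁻¹) := by
  have hx1 : 1 < ‖x‖ := by linarith
  rw [h.velocity_add_velocity_neg α hx1, norm_smul]
  have hπ : ‖(2 * Real.pi)⁻¹‖ ≤ 1 := by
    rw [Real.norm_of_nonneg (by positivity)]
    exact inv_le_one_of_one_le₀ (by linarith [Real.pi_gt_three])
  have hd := h.sub_comp_neg
  have hi : Integrable fun y => |w y - w (-y)| * (‖x - y‖⁻¹ + δ⁻¹) := by
    have := (hd.integrable_inv_norm_mul x).add (hd.integrable.abs.const_mul δ⁻¹)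
    refine this.congr (Filter.Eventually.of_forall fun y => ?_)
    simp only [Pi.add_apply]
    ring
  calc _ ≤ 1 * ‖∫ y, (w y - w (-y)) • biotSavartKernel x y‖ := by gcongr
    _ = ‖∫ y, (w y - w (-y)) • biotSavartKernel x y‖ := one_mul _
    _ ≤ _ := by
      refine norm_integral_le_of_norm_le hi (Filter.Eventually.of_forall fun y => ?_)
      by_cases hy : y ∈ exteriorDisk
      · rw [norm_smul, Real.norm_eq_abs]
        gcongr
        refine (norm_biotSavartKernel_le hx1 hy).trans ?_
        gcongr
        linarith
      · simp [hd.eq_zero y hy]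

end

section
variable {α : ℝ} {ω₀ : Plane → ℝ} {ω : ℝ → Plane → ℝ}

/-- The derivative within $[0,\infty)\times D^c$ is continuous up to time `0`, so compactness gives
a bound that does not degenerate as $t\to0$. -/
lemma exists_fderiv_bound {G : ℝ → Plane → ℝ} {K : Set Plane}
    (hG : ContDiffOn ℝ 1 (fun p : ℝ × Plane => G p.1 p.2) (Ici 0 ×ˢ exteriorDisk))
    (hK : IsCompact K) (hKD : K ⊆ exteriorDisk) (T : ℝ) :
    ∃ D, 0 ≤ D ∧ ∀ t ∈ Ioo 0 T, ∀ x ∈ K, ∀ v, |fderiv ℝ (G t) x v| ≤ D * ‖v‖ := by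
  have hu : UniqueDiffOn ℝ (Ici (0 : ℝ) ×ˢ exteriorDisk) :=
    (uniqueDiffOn_Ici 0).prod isOpen_exteriorDisk.uniqueDiffOn
  have hcont := (hG.continuousOn_fderivWithin hu le_rfl).mono
    (prod_mono Icc_subset_Ici_self hKD : Icc 0 T ×ˢ K ⊆ Ici (0 : ℝ) ×ˢ exteriorDisk)
  obtain ⟨D, hD⟩ := (isCompact_Icc.prod hK).exists_bound_of_continuousOn hcont
  refine ⟨max D 0, le_max_right _ _, fun t ht x hx v => ?_⟩
  have h1 := hD (t, x) ⟨Ioo_subset_Icc_self ht, hx⟩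
  have hn : Ici (0 : ℝ) ×ˢ exteriorDisk ∈ nhds (t, x) :=
    Filter.mem_of_superset (isOpen_positive_time.mem_nhds ⟨ht.1, hKD hx⟩)
      (prod_mono Ioi_subset_Ici_self subset_rfl)
  rw [fderivWithin_of_mem_nhds hn] at h1
  have h2 := ((contDiffAt_uncurry_of_contDiffOn hG ht.1 (hKD hx)).differentiableAt
    one_ne_zero).hasFDerivAt.comp x (hasFDerivAt_prodMk_right t x)
  have h3 : fderiv ℝ (G t) x = (fderiv ℝ (fun p : ℝ × Plane => G p.1 p.2) (t, x)).comp
    (ContinuousLinearMap.inr ℝ ℝ Plane) := h2.fderiv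
  rw [h3, ContinuousLinearMap.comp_apply, ContinuousLinearMap.inr_apply, ← Real.norm_eq_abs]
  refine (ContinuousLinearMap.le_opNorm _ _).trans ?_
  rw [Prod.norm_mk, norm_zero, max_eq_right (norm_nonneg v)]
  gcongr
  exact h1.trans (le_max_left _ _)

/-- Solutions with even initial vorticity remain even. -/
lemma IsExtendedSolution.even (h : IsExtendedSolution α ω₀ ω) (h₀ : IsEvenDatum ω₀) {t : ℝ}
    (ht : 0 ≤ t) (x : Plane) : ω t (-x) = ω t x := by
  obtain ⟨a, b, ha, hab⟩ := h.exists_closedAnnulus h₀.hasCompactSupport h₀.tsupport_subset t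
  set K := closedAnnulus a b with hKdef
  have hK : IsCompact K := isCompact_closedAnnulus a b
  have hKD : K ⊆ exteriorDisk := closedAnnulus_subset ha
  have hKneg : ∀ y, -y ∈ K ↔ y ∈ K := fun y => by simp [hKdef, closedAnnulus]
  have hDneg : ∀ y, -y ∈ exteriorDisk ↔ y ∈ exteriorDisk := fun y => by simp [exteriorDisk]
  obtain ⟨A, B, hAB⟩ := h.exists_bound t
  obtain ⟨D, hD0, hD⟩ := exists_fderiv_bound h.solution.contDiffOn hK hKD t
  set w : ℝ → Plane → ℝ := fun s y => ω s y - ω s (-y) with hw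
  have hw0 : ∀ s ∈ Icc 0 t, ∀ y, y ∉ K → w s y = 0 := fun s hs y hy => by
    simp [hw, hab s hs y hy, hab s hs (-y) (by rwa [hKneg])]
  have hwC : ContDiffOn ℝ 1 (fun p : ℝ × Plane => w p.1 p.2) (Ici 0 ×ˢ exteriorDisk) := by
    refine h.solution.contDiffOn.sub (h.solution.contDiffOn.comp
      (f := fun p : ℝ × Plane => (p.1, -p.2)) (by fun_prop) fun p hp => ⟨hp.1, ?_⟩)
    exact (hDneg _).2 hp.2
  have hGC : ContDiffOn ℝ 1 (fun p : ℝ × Plane => (fun s y => w s y ^ 2) p.1 p.2)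
      (Ici 0 ×ˢ exteriorDisk) := hwC.pow 2
  have hG0 : ∀ s ∈ Icc 0 t, ∀ y, y ∉ K → w s y ^ 2 = 0 := fun s hs y hy => by
    simp [hw0 s hs y hy]
  obtain ⟨δ, hδ, hδK⟩ : ∃ δ > 0, ∀ y ∈ K, 1 + δ ≤ ‖y‖ := by
    refine ⟨√a - 1, ?_, fun y hy => ?_⟩
    · rw [gt_iff_lt, sub_pos]; exact Real.lt_sqrt_of_sq_lt (by simpa)
    · rw [add_sub_cancel, Real.sqrt_le_left (norm_nonneg _)]; exact hy.1
  set C := 2 * D * (2 * Real.pi + volume.real K + δ⁻¹ * volume.real K) with hC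
  have hderiv := fun s (hs : s ∈ Ioo 0 t) => hasDerivAt_integral_material hGC hK hKD hG0 hs
    (hAB s (Ioo_subset_Icc_self hs)) α
  have hE : ∫ y, w t y ^ 2 = 0 := by
    refine eq_zero_of_deriv_le_mul (C := C)
      (continuousOn_integral_of_eq_zero_off_compact hGC hK hKD hG0)
      (fun s hs => (hderiv s hs).2) (fun s hs => ?_) ?_
      (fun s _ => integral_nonneg fun y => sq_nonneg _) ⟨ht, le_rfl⟩
    · have hs' := Ioo_subset_Icc_self hs
      obtain ⟨j1, j2⟩ := (hAB s hs').sub_comp_neg.integral_mul_integral_le hK hKD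
        (hw0 s hs') (inv_nonneg.2 hδ.le)
      have hpt : ∀ y, deriv (fun r => w r y ^ 2) s +
          fderiv ℝ (fun y => w s y ^ 2) y (velocity α (ω s) y) ≤
          2 * D * (|w s y| * ∫ z, |w s z| * (‖y - z‖⁻¹ + δ⁻¹)) := by
        intro y
        by_cases hy : y ∈ K
        · have hyD := hKD hy
          have hyD' := (hDneg y).2 hyD
          have d1 := (differentiableAt_time_slice h.solution.contDiffOn hs.1 hyD).hasDerivAt
          have d2 := (differentiableAt_time_slice h.solution.contDiffOn hs.1 hyD').hasDerivAt
          have d3 := (differentiableAt_space_slice h.solution.contDiffOn hs.1.le hyD).hasFDerivAt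
          have d4 : HasFDerivAt (fun y => ω s (-y)) (-fderiv ℝ (ω s) (-y)) y := by
            have := (differentiableAt_space_slice h.solution.contDiffOn hs.1.le hyD').hasFDerivAt
            exact (this.comp y (hasFDerivAt_id y).neg).congr_fderiv (by ext; simp)
          have e1 : deriv (fun r => w r y ^ 2) s = 2 * w s y *
              (deriv (fun r => ω r y) s - deriv (fun r => ω r (-y)) s) := by
            refine ((d1.sub d2).pow 2).deriv.trans ?_
            simp [hw]
          have e2 : fderiv ℝ (fun y => w s y ^ 2) y = (2 * w s y) •
              (fderiv ℝ (ω s) y + fderiv ℝ (ω s) (-y)) := by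
            refine ((d3.sub d4).pow 2).fderiv.trans ?_
            simp [hw]
          have t1 := h.solution.transport s hs.1 y hyD
          have t2 := h.solution.transport s hs.1 (-y) hyD'
          -- Subtracting the equations at $y$ and $-y$ leaves $\nabla\omega(-y)$ applied to
          -- $u(y)+u(-y)$, which is controlled by $w$ itself, so the $L^2$ norm of $w$ obeys a
          -- Grönwall inequality.
          have e3 : deriv (fun r => w r y ^ 2) s +
              fderiv ℝ (fun y => w s y ^ 2) y (velocity α (ω s) y) =
              2 * (w s y * fderiv ℝ (ω s) (-y)
                (velocity α (ω s) y + velocity α (ω s) (-y))) := by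
            rw [e1, e2, map_add]
            simp only [add_apply, smul_apply, smul_eq_mul]
            linear_combination (2 * w s y) * (t1 - t2)
          have b1 := hD s hs (-y) ((hKneg y).2 hy) (velocity α (ω s) y + velocity α (ω s) (-y))
          have b2 := (hAB s hs').norm_velocity_add_velocity_neg_le α hδ (hδK y hy)
          rw [e3]
          calc _ ≤ 2 * (|w s y| * |fderiv ℝ (ω s) (-y)
                (velocity α (ω s) y + velocity α (ω s) (-y))|) := by
                rw [← abs_mul]
                gcongr
                exact le_abs_self _
            _ ≤ 2 * (|w s y| * (D * ∫ z, |w s z| * (‖y - z‖⁻¹ + δ⁻¹))) := by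
                gcongr
                exact b1.trans (by gcongr)
            _ = _ := by ring
        · have e1 : deriv (fun r => w r y ^ 2) s = 0 := by
            have : (fun r => w r y ^ 2) =ᶠ[nhds s] fun _ => 0 := by
              filter_upwards [isOpen_Ioo.mem_nhds hs] with r hr
              exact hG0 r (Ioo_subset_Icc_self hr) y hy
            rw [this.deriv_eq, deriv_const]
          have e2 : fderiv ℝ (fun y => w s y ^ 2) y = 0 := by
            have : (fun y => w s y ^ 2) =ᶠ[nhds y] fun _ => 0 := by
              filter_upwards [hK.isClosed.isOpen_compl.mem_nhds hy] with z hz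
              exact hG0 s hs' z hz
            rw [this.fderiv_eq, fderiv_const_apply]
          rw [e1, e2, hw0 s hs' y hy]
          simp
      calc _ ≤ ∫ y, 2 * D * (|w s y| * ∫ z, |w s z| * (‖y - z‖⁻¹ + δ⁻¹)) :=
            integral_mono (hderiv s hs).1 (j1.const_mul _) hpt
        _ ≤ _ := by
            rw [integral_const_mul, hC, mul_assoc (2 * D)]
            gcongr
    · simp [hw, h.initial_eq h₀, h₀.even]
  obtain ⟨g1, g2, -⟩ := contDiff_of_contDiffOn_of_eq_zero (g := fun y => w t y ^ 2) hK hKD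
    (contDiffOn_space_slice (G := fun s y => w s y ^ 2) hGC ht) (hG0 t ⟨ht, le_rfl⟩)
  have h1 := eq_zero_of_integral_eq_zero g1 g2 (fun y => sq_nonneg _) hE x
  have h2 : w t x = 0 := by simpa using h1
  simp only [hw] at h2
  linarith

end

/-! ### Symmetrized moment integrals. -/

lemma one_lt_norm_of_mem {x : Plane} (hx : x ∈ exteriorDisk) : 1 < ‖x‖ := hx

section
variable {w : Plane → ℝ} {A B a b : ℝ}

lemma IsBoundedVorticity.integrable_mul_norm_pow (h : IsBoundedVorticity w A B)
    (h0 : ∀ x, x ∉ closedAnnulus a b → w x = 0) (k : ℕ) :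
    Integrable fun x => w x * (‖x‖ ^ 2) ^ k := by
  refine (h.integrable.abs.mul_const (b ^ k)).mono'
    (h.integrable.aestronglyMeasurable.mul (by fun_prop)) (Filter.Eventually.of_forall fun x => ?_)
  by_cases hx : x ∈ closedAnnulus a b
  · rw [norm_mul, Real.norm_eq_abs, Real.norm_of_nonneg (by positivity)]
    gcongr
    exact hx.2
  · simp [h0 x hx]

lemma IsBoundedVorticity.integrable_prod_radialKernel (h : IsBoundedVorticity w A B)
    (h0 : ∀ x, x ∉ closedAnnulus a b → w x = 0) (k : ℕ) :
    Integrable (fun p : Plane × Plane =>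
      w p.1 * w p.2 * ((‖p.1‖ ^ 2) ^ k * radialKernel p.1 p.2)) (volume.prod volume) := by
  refine ((h.integrable_prod_inv_norm h).const_mul (b ^ k * b)).mono' ?_
    (Filter.Eventually.of_forall fun p => ?_)
  · exact (h.integrable.mul_prod h.integrable).aestronglyMeasurable.mul
      ((by fun_prop : Measurable fun p : Plane × Plane => (‖p.1‖ ^ 2) ^ k).mul
        measurable_radialKernel).aestronglyMeasurable
  · by_cases h1 : p.1 ∈ exteriorDisk
    · by_cases h2 : p.2 ∈ exteriorDisk
      · by_cases h3 : p.1 ∈ closedAnnulus a b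
        · have hb := h3.2
          have hn : ‖p.1‖ ≤ b := by nlinarith [one_lt_norm_of_mem h1]
          have hb0 : 0 ≤ b := (norm_nonneg _).trans hn
          rw [norm_mul, norm_mul, norm_mul, Real.norm_of_nonneg (by positivity :
            0 ≤ (‖p.1‖ ^ 2) ^ k)]
          simp only [Real.norm_eq_abs]
          calc _ ≤ |w p.1| * |w p.2| * (b ^ k * (b * ‖p.1 - p.2‖⁻¹)) := by
                gcongr
                refine (abs_radialKernel_le_left h1 h2).trans ?_
                gcongr
            _ = _ := by ring
        · simp [h0 p.1 h3]
      · simp [h.eq_zero p.2 h2]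
    · simp [h.eq_zero p.1 h1]

/-- Symmetrization in the two variables of the quadratic form of the radial velocity. -/
lemma IsBoundedVorticity.two_mul_integral_radialKernel (h : IsBoundedVorticity w A B)
    (h0 : ∀ x, x ∉ closedAnnulus a b → w x = 0) (k : ℕ) :
    Integrable (fun p : Plane × Plane =>
      w p.1 * w p.2 * (((‖p.1‖ ^ 2) ^ k - (‖p.2‖ ^ 2) ^ k) * radialKernel p.1 p.2))
      (volume.prod volume) ∧
    2 * ∫ x, w x * ((‖x‖ ^ 2) ^ k * ∫ y, radialKernel x y * w y) =
      ∫ p : Plane × Plane, w p.1 * w p.2 *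
        (((‖p.1‖ ^ 2) ^ k - (‖p.2‖ ^ 2) ^ k) * radialKernel p.1 p.2) ∂(volume.prod volume) := by
  have i1 := h.integrable_prod_radialKernel h0 k
  have i2 : Integrable (fun p : Plane × Plane =>
      w p.swap.1 * w p.swap.2 * ((‖p.swap.1‖ ^ 2) ^ k * radialKernel p.swap.1 p.swap.2))
      (volume.prod volume) := i1.swap
  have e0 : ∀ x, w x * ((‖x‖ ^ 2) ^ k * ∫ y, radialKernel x y * w y) =
      ∫ y, w x * w y * ((‖x‖ ^ 2) ^ k * radialKernel x y) := fun x => by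
    rw [← integral_const_mul, ← integral_const_mul]
    congr 1; ext y; ring
  have e1 : ∀ p : Plane × Plane, w p.1 * w p.2 *
      (((‖p.1‖ ^ 2) ^ k - (‖p.2‖ ^ 2) ^ k) * radialKernel p.1 p.2) =
      w p.1 * w p.2 * ((‖p.1‖ ^ 2) ^ k * radialKernel p.1 p.2) +
      w p.swap.1 * w p.swap.2 * ((‖p.swap.1‖ ^ 2) ^ k * radialKernel p.swap.1 p.swap.2) := by
    intro p
    simp only [Prod.fst_swap, Prod.snd_swap]
    by_cases h1 : p.1 ∈ exteriorDisk
    · by_cases h2 : p.2 ∈ exteriorDisk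
      · rw [radialKernel_swap h1 h2]; ring
      · simp [h.eq_zero p.2 h2]
    · simp [h.eq_zero p.1 h1]
  simp only [e0, e1]
  refine ⟨i1.add i2, ?_⟩
  rw [integral_integral (f := fun x y => w x * w y * ((‖x‖ ^ 2) ^ k * radialKernel x y)) i1,
    integral_add i1 i2,
    integral_prod_swap fun p : Plane × Plane =>
      w p.1 * w p.2 * ((‖p.1‖ ^ 2) ^ k * radialKernel p.1 p.2)]
  ring

lemma measurePreserving_neg_snd :
    MeasurePreserving (fun p : Plane × Plane => (p.1, -p.2)) (volume.prod volume)
      (volume.prod volume) :=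
  (MeasurePreserving.id volume).prod (Measure.measurePreserving_neg volume)

lemma measurableEmbedding_neg_snd :
    MeasurableEmbedding (fun p : Plane × Plane => (p.1, -p.2)) :=
  (MeasurableEquiv.prodCongr (MeasurableEquiv.refl Plane)
    (MeasurableEquiv.neg Plane)).measurableEmbedding

/-- Exchanging $x$ and $y$ produces the difference of weights, and reflecting $y$ produces
$K(x,y)+K(x,-y)$. The two symmetrizations make four copies of the integral, to which
`moment_kernel_le` applies. -/
lemma IsBoundedVorticity.abs_integral_moment_le (h : IsBoundedVorticity w A B)
    (h0 : ∀ x, x ∉ closedAnnulus a b → w x = 0) (hpos : ∀ x, 0 ≤ w x) (heven : ∀ x, w (-x) = w x)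
    (q : ℕ) :
    |∫ x, w x * ((‖x‖ ^ 2) ^ (q + 1) * ∫ y, radialKernel x y * w y)| ≤
      4 * (q + 1) * ((∫ x, w x * (‖x‖ ^ 2) ^ q) * ∫ x, w x * ‖x‖ ^ 2) := by
  obtain ⟨i1, e1⟩ := h.two_mul_integral_radialKernel h0 (q + 1)
  set J := ∫ x, w x * ((‖x‖ ^ 2) ^ (q + 1) * ∫ y, radialKernel x y * w y)
  have i2 := measurePreserving_neg_snd.integrable_comp_of_integrable i1
  have e2 := measurePreserving_neg_snd.integral_comp measurableEmbedding_neg_snd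
    (fun p : Plane × Plane => w p.1 * w p.2 *
      (((‖p.1‖ ^ 2) ^ (q + 1) - (‖p.2‖ ^ 2) ^ (q + 1)) * radialKernel p.1 p.2))
  have e3 : 4 * J = ∫ p : Plane × Plane, w p.1 * w p.2 *
      (((‖p.1‖ ^ 2) ^ (q + 1) - (‖p.2‖ ^ 2) ^ (q + 1)) *
        (radialKernel p.1 p.2 + radialKernel p.1 (-p.2))) ∂(volume.prod volume) := by
    have e4 := integral_add i1 i2
    simp only [Function.comp_def] at e4
    rw [e2, ← e1] at e4
    rw [show 4 * J = 2 * J + 2 * J by ring, ← e4]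
    congr 1
    ext p
    rw [heven, norm_neg]
    ring
  have j1 := h.integrable_mul_norm_pow h0 q
  have j2 : Integrable fun x => w x * ‖x‖ ^ 2 := by simpa using h.integrable_mul_norm_pow h0 1
  have j3 := j1.mul_prod (μ := volume) (ν := volume) j2
  have j4 := j2.mul_prod (μ := volume) (ν := volume) j1
  have e5 : |4 * J| ≤ ∫ p : Plane × Plane, 8 * ((q : ℝ) + 1) *
      ((w p.1 * (‖p.1‖ ^ 2) ^ q) * (w p.2 * ‖p.2‖ ^ 2) +
        (w p.1 * ‖p.1‖ ^ 2) * (w p.2 * (‖p.2‖ ^ 2) ^ q)) ∂(volume.prod volume) := by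
    rw [e3]
    refine abs_integral_le_of_abs_le ((j3.add j4).const_mul _) fun p => ?_
    by_cases h1 : p.1 ∈ exteriorDisk
    · by_cases h2 : p.2 ∈ exteriorDisk
      · have hw : 0 ≤ w p.1 * w p.2 := mul_nonneg (hpos _) (hpos _)
        rw [abs_mul, abs_of_nonneg hw]
        refine (mul_le_mul_of_nonneg_left (moment_kernel_le h1 h2 q) hw).trans (le_of_eq ?_)
        ring
      · simp [h.eq_zero p.2 h2]
    · simp [h.eq_zero p.1 h1]
  have e6 := integral_prod_mul (μ := volume) (ν := volume)
    (fun x : Plane => w x * (‖x‖ ^ 2) ^ q) (fun x : Plane => w x * ‖x‖ ^ 2)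
  have e7 := integral_prod_mul (μ := volume) (ν := volume)
    (fun x : Plane => w x * ‖x‖ ^ 2) (fun x : Plane => w x * (‖x‖ ^ 2) ^ q)
  rw [integral_const_mul, integral_add j3 j4, e6, e7, abs_mul,
    abs_of_pos (by norm_num : (0 : ℝ) < 4)] at e5
  linarith

/-- The weight with exponent `0` is constant, so its symmetrized difference vanishes. -/
lemma IsBoundedVorticity.integral_radialKernel_eq_zero (h : IsBoundedVorticity w A B)
    (h0 : ∀ x, x ∉ closedAnnulus a b → w x = 0) :
    ∫ x, w x * ∫ y, radialKernel x y * w y = 0 := by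
  have := (h.two_mul_integral_radialKernel h0 0).2
  simpa using this

end

/-! ### Evolution of the moments. -/

section
variable {α : ℝ} {ω₀ : Plane → ℝ} {ω : ℝ → Plane → ℝ}

lemma IsExtendedSolution.hasDerivAt_moment (h : IsExtendedSolution α ω₀ ω) (h₀ : IsEvenDatum ω₀)
    (k : ℕ) (T : ℝ) :
    ContinuousOn (fun t => ∫ x, ω t x * (‖x‖ ^ 2) ^ (k + 1)) (Icc 0 T) ∧ ∀ t ∈ Ioo 0 T,
      HasDerivAt (fun t => ∫ x, ω t x * (‖x‖ ^ 2) ^ (k + 1)) ((k + 1) / Real.pi *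
        ∫ x, ω t x * ((‖x‖ ^ 2) ^ k * ∫ y, radialKernel x y * ω t y)) t := by
  have hφ : ContDiff ℝ 1 fun p : ℝ × Plane => (‖p.2‖ ^ 2) ^ (k + 1) :=
    ((contDiff_norm_sq ℝ).comp contDiff_snd).pow _
  obtain ⟨h1, h2⟩ := h.hasDerivAt_integral_mul h₀ (β := fun r => r) contDiff_id rfl
    (φ := fun _ x => (‖x‖ ^ 2) ^ (k + 1)) hφ.contDiffOn T
  refine ⟨h1, fun t ht => (h2 t ht).congr_deriv ?_⟩
  obtain ⟨A, B, hAB⟩ := h.exists_bound T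
  have hw := hAB t (Ioo_subset_Icc_self ht)
  rw [← integral_const_mul]
  congr 1
  ext x
  by_cases hx : x ∈ exteriorDisk
  · have e1 : fderiv ℝ (fun x : Plane => (‖x‖ ^ 2) ^ (k + 1)) x =
        (((k + 1 : ℕ) : ℝ) * (‖x‖ ^ 2) ^ k) • (2 • (innerSL ℝ x)) := by
      simpa using ((hasFDerivAt_norm_sq x).pow (k + 1)).fderiv
    rw [e1, deriv_const, zero_add]
    simp only [smul_apply, innerSL_apply_apply, hw.inner_velocity α hx, smul_eq_mul, nsmul_eq_mul]
    push_cast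
    field_simp
  · simp [h.eq_zero t x hx]

/-- The moment of inertia is conserved. -/
lemma IsExtendedSolution.integral_mul_norm_sq (h : IsExtendedSolution α ω₀ ω)
    (h₀ : IsEvenDatum ω₀) {t : ℝ} (ht : 0 ≤ t) :
    ∫ x, ω t x * ‖x‖ ^ 2 = ∫ x, ω₀ x * ‖x‖ ^ 2 := by
  have key := h.hasDerivAt_moment h₀ 0
  simp only [zero_add, pow_one, pow_zero, one_mul] at key
  have hzero : ∀ t, 0 < t → HasDerivAt (fun t => ∫ x, ω t x * ‖x‖ ^ 2) 0 t := by
    intro t ht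
    refine ((key (t + 1)).2 t ⟨ht, by linarith⟩).congr_deriv ?_
    obtain ⟨A, B, hAB⟩ := h.exists_bound t
    obtain ⟨a, b, ha, hab⟩ := h.exists_closedAnnulus h₀.hasCompactSupport h₀.tsupport_subset t
    rw [(hAB t ⟨ht.le, le_rfl⟩).integral_radialKernel_eq_zero (hab t ⟨ht.le, le_rfl⟩), mul_zero]
  rw [eq_initial_of_deriv_eq_zero (fun T => (key T).1) hzero ht, h.initial_eq h₀]

/-- Growth of the moments of the vorticity. -/
lemma IsExtendedSolution.moment_le (h : IsExtendedSolution α ω₀ ω) (h₀ : IsEvenDatum ω₀)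
    {ρ : ℝ} (hρ0 : 0 ≤ ρ) (hρ : ∀ x, ω₀ x ≠ 0 → (‖x‖ ^ 2) ^ 2 ≤ ρ) (n : ℕ) {t : ℝ} (ht : 0 ≤ t) :
    ∫ x, ω t x * (‖x‖ ^ 2) ^ (2 * n) ≤
      (∫ x, ω₀ x) * (ρ + 8 * (∫ x, ω₀ x * ‖x‖ ^ 2) * n * t) ^ n := by
  have hm : 0 ≤ ∫ x, ω₀ x := integral_nonneg h₀.nonneg
  have hI : 0 ≤ ∫ x, ω₀ x * ‖x‖ ^ 2 :=
    integral_nonneg fun x => mul_nonneg (h₀.nonneg x) (sq_nonneg _)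
  set m := ∫ x, ω₀ x
  set I := ∫ x, ω₀ x * ‖x‖ ^ 2
  induction n generalizing t with
  | zero => simp [h.integral_eq h₀ ht, m]
  | succ n ih =>
    -- The derivative of the moment of order $2n+2$ in $|x|^2$ is controlled by that of order $2n$
    -- times the conserved inertia, so the induction advances by $|x|^4$.
    obtain ⟨h1, h2⟩ := h.hasDerivAt_moment h₀ (2 * n + 1) t
    have hb : ∀ s, HasDerivAt (fun s => m * (ρ + 8 * I * (n + 1 : ℕ) * s) ^ (n + 1))
        (m * ((n + 1 : ℕ) * (ρ + 8 * I * (n + 1 : ℕ) * s) ^ n * (8 * I * (n + 1 : ℕ)))) s := by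
      intro s
      have := (((hasDerivAt_id s).const_mul (8 * I * (n + 1 : ℕ))).const_add ρ).pow (n + 1)
      simpa using this.const_mul m
    have hanti : AntitoneOn (fun s => (∫ x, ω s x * (‖x‖ ^ 2) ^ (2 * n + 1 + 1)) -
        m * (ρ + 8 * I * (n + 1 : ℕ) * s) ^ (n + 1)) (Icc 0 t) := by
      apply antitoneOn_of_deriv_nonpos (convex_Icc 0 t)
      · exact h1.sub (by fun_prop)
      · rw [interior_Icc]
        exact fun s hs => ((h2 s hs).sub (hb s)).differentiableAt.differentiableWithinAt
      · rw [interior_Icc]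
        intro s hs
        have e := ((h2 s hs).sub (hb s)).deriv
        have e' : deriv (fun s => (∫ x, ω s x * (‖x‖ ^ 2) ^ (2 * n + 1 + 1)) -
          m * (ρ + 8 * I * (n + 1 : ℕ) * s) ^ (n + 1)) s = _ := e
        rw [e', sub_nonpos]
        obtain ⟨A, B, hAB⟩ := h.exists_bound s
        obtain ⟨a, b, ha, hab⟩ := h.exists_closedAnnulus h₀.hasCompactSupport h₀.tsupport_subset s
        have hs' : s ∈ Icc 0 s := ⟨hs.1.le, le_rfl⟩
        have key := (le_abs_self _).trans ((hAB s hs').abs_integral_moment_le (hab s hs')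
          (h.nonneg h₀ hs.1.le) (h.even h₀ hs.1.le) (2 * n))
        rw [h.integral_mul_norm_sq h₀ hs.1.le] at key
        have hπ : 0 < Real.pi := Real.pi_pos
        have hs0 := hs.1.le
        have hpow : (ρ + 8 * I * n * s) ^ n ≤ (ρ + 8 * I * (n + 1 : ℕ) * s) ^ n := by
          gcongr
          exact n.le_succ
        calc _ ≤ ((2 * n + 1 : ℕ) + 1) / Real.pi *
              (4 * ((2 * n : ℕ) + 1) * (m * (ρ + 8 * I * (n + 1 : ℕ) * s) ^ n * I)) := by
              gcongr
              refine key.trans ?_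
              gcongr
              exact (ih hs0).trans (by gcongr)
          _ = ((2 * (n + 1)) * (4 * (2 * n + 1)) / Real.pi) *
              (m * (ρ + 8 * I * (n + 1 : ℕ) * s) ^ n * I) := by push_cast; ring
          -- Since $2n+1\le\pi(n+1)$, the constant 8 makes the right side exactly the time
          -- derivative of the proposed bound.
          _ ≤ (8 * (n + 1) * (n + 1)) * (m * (ρ + 8 * I * (n + 1 : ℕ) * s) ^ n * I) := by
              gcongr
              rw [div_le_iff₀ hπ]
              have : (n + 1 : ℝ) * (2 * n + 1) ≤ (n + 1) * ((n + 1) * Real.pi) := by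
                gcongr
                nlinarith [Real.pi_gt_three, (Nat.cast_nonneg n : (0 : ℝ) ≤ n)]
              linarith
          _ = _ := by push_cast; ring
    have h3 := hanti ⟨le_rfl, ht⟩ ⟨ht, le_rfl⟩ ht
    have h4 : ∫ x, ω 0 x * (‖x‖ ^ 2) ^ (2 * n + 1 + 1) ≤ m * ρ ^ (n + 1) := by
      rw [h.initial_eq h₀, ← integral_mul_const]
      obtain ⟨g1, g2, -⟩ := h.contDiff_hasCompactSupport h₀ (le_refl (0 : ℝ))
      rw [h.initial_eq h₀] at g1 g2
      refine integral_mono ?_ ((g1.continuous.integrable_of_hasCompactSupport g2).mul_const _)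
        fun x => ?_
      · exact (g1.continuous.mul (by fun_prop)).integrable_of_hasCompactSupport g2.mul_right
      · by_cases hx : ω₀ x = 0
        · simp [hx]
        · have := hρ x hx
          have hp := h₀.nonneg x
          dsimp only
          rw [show 2 * n + 1 + 1 = 2 * (n + 1) by ring, pow_mul (‖x‖ ^ 2) 2 (n + 1)]
          gcongr
    simp only [mul_zero, add_zero] at h3
    rw [show 2 * (n + 1) = 2 * n + 1 + 1 by ring]
    linarith

end

/-! ### Far-field radial velocity. -/

section
variable {w : Plane → ℝ} {A B : ℝ}

/-- The radial velocity of an even vorticity, in terms of its moment of inertia and of the mass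
far away. -/
lemma IsBoundedVorticity.abs_integral_radialKernel_far_le (h : IsBoundedVorticity w A B)
    (hpos : ∀ x, 0 ≤ w x) (heven : ∀ x, w (-x) = w x)
    (hI : Integrable fun y => w y * ‖y‖ ^ 2) {x : Plane} (hx : 1 < ‖x‖) {r : ℝ} (hr : 0 < r)
    (htail : ∫ y, {y : Plane | ‖x‖ < 2 * ‖y‖}.indicator w y ≤ r ^ 2) :
    |∫ y, radialKernel x y * w y| ≤
      4 * (∫ y, w y * ‖y‖ ^ 2) / ‖x‖ ^ 2 + ‖x‖ * (r * (2 * Real.pi * B + 1)) := by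
  set S : Set Plane := {y : Plane | ‖x‖ < 2 * ‖y‖} with hS
  have hSm : MeasurableSet S := measurableSet_lt measurable_const (by fun_prop)
  have hfar : IsBoundedVorticity (S.indicator w) (r ^ 2) B := by
    refine ⟨fun y hy => ?_, h.integrable.indicator hSm, ?_, fun y => ?_⟩
    · rw [indicator_apply, h.eq_zero y hy, ite_self]
    · simp only [abs_of_nonneg (indicator_nonneg (fun z _ => hpos z) _)]
      exact htail
    · rw [indicator_apply]
      split_ifs
      · exact h.abs_le y
      · simpa using h.nonneg_right
  have hnear : IsBoundedVorticity (Sᶜ.indicator w) A B := by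
    refine ⟨fun y hy => ?_, h.integrable.indicator hSm.compl, ?_, fun y => ?_⟩
    · rw [indicator_apply, h.eq_zero y hy, ite_self]
    · refine le_trans (integral_mono (h.integrable.indicator hSm.compl).abs h.integrable.abs
        fun y => ?_) h.integral_abs_le
      rw [indicator_apply]
      split_ifs <;> simp
    · rw [indicator_apply]
      split_ifs
      · exact h.abs_le y
      · simpa using h.nonneg_right
  have hsplit : ∫ y, radialKernel x y * w y = (∫ y, radialKernel x y * Sᶜ.indicator w y) +
      ∫ y, radialKernel x y * S.indicator w y := by
    rw [← integral_add (hnear.integrable_radialKernel_mul hx) (hfar.integrable_radialKernel_mul hx)]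
    congr 1
    ext y
    rw [← mul_add, add_comm, ← Pi.add_apply, indicator_self_add_compl]
  -- The far mass is at most $r^2$, so cutting the kernel at distance $r$ gives a contribution
  -- linear in $r$.
  have b2 := hfar.abs_integral_radialKernel_mul_le hx hr
  have e2 : ‖x‖ * (2 * Real.pi * r * B + r⁻¹ * r ^ 2) = ‖x‖ * (r * (2 * Real.pi * B + 1)) := by
    field_simp
  rw [e2] at b2
  have i1 := hnear.integrable_radialKernel_mul hx
  have hevenS : ∀ y, Sᶜ.indicator w (-y) = Sᶜ.indicator w y := fun y => by
    simp only [indicator_apply, heven, hS, mem_compl_iff, mem_ofPred_eq, norm_neg]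
  -- The near region $2|y|\le|x|$ is symmetric under $y\mapsto-y$, so its vorticity stays even and
  -- the cancellation estimate applies.
  have e3 : 2 * ∫ y, radialKernel x y * Sᶜ.indicator w y =
      ∫ y, (radialKernel x y + radialKernel x (-y)) * Sᶜ.indicator w y := by
    have i2 := i1.comp_neg
    simp only [hevenS] at i2
    have e4 := integral_neg_eq_self (fun y => radialKernel x y * Sᶜ.indicator w y) volume
    simp only [hevenS] at e4
    simp only [add_mul]
    rw [integral_add i1 i2, e4]
    ring
  have b1 : |2 * ∫ y, radialKernel x y * Sᶜ.indicator w y| ≤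
      ∫ y, 8 / ‖x‖ ^ 2 * (w y * ‖y‖ ^ 2) := by
    rw [e3]
    refine abs_integral_le_of_abs_le (hI.const_mul _) fun y => ?_
    have hwy := hpos y
    by_cases hy : y ∈ exteriorDisk
    · by_cases hyS : y ∈ S
      · rw [indicator_of_notMem (by simpa using hyS), mul_zero, abs_zero]
        positivity
      · rw [indicator_of_mem hyS, abs_mul, abs_of_nonneg hwy]
        have hle : 2 * ‖y‖ ≤ ‖x‖ := not_lt.1 hyS
        calc _ ≤ 8 * ‖y‖ ^ 2 / ‖x‖ ^ 2 * w y := by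
              gcongr
              exact abs_radialKernel_add_neg_le hy hle
          _ = _ := by ring
    · rw [hnear.eq_zero y hy, mul_zero, abs_zero]
      positivity
  rw [integral_const_mul, abs_mul, abs_of_pos (by norm_num : (0 : ℝ) < 2)] at b1
  rw [hsplit]
  refine (abs_add_le _ _).trans (add_le_add ?_ b2)
  have : 8 / ‖x‖ ^ 2 * (∫ y, w y * ‖y‖ ^ 2) = 2 * (4 * (∫ y, w y * ‖y‖ ^ 2) / ‖x‖ ^ 2) := by ring
  linarith

/-- Chebyshev's inequality with weight $(2|y|/R)^{4n}$. -/
lemma IsBoundedVorticity.integral_tail_le (h : IsBoundedVorticity w A B) {a b : ℝ}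
    (h0 : ∀ x, x ∉ closedAnnulus a b → w x = 0) (hpos : ∀ x, 0 ≤ w x) {R : ℝ} (hR : 0 < R) (n : ℕ) :
    ∫ y, {y : Plane | R < 2 * ‖y‖}.indicator w y ≤
      (16 / (R ^ 2) ^ 2) ^ n * ∫ y, w y * (‖y‖ ^ 2) ^ (2 * n) := by
  have hSm : MeasurableSet {y : Plane | R < 2 * ‖y‖} :=
    measurableSet_lt measurable_const (by fun_prop)
  rw [← integral_const_mul]
  refine integral_mono (h.integrable.indicator hSm)
    ((h.integrable_mul_norm_pow h0 (2 * n)).const_mul _) fun y => ?_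
  have hwy := hpos y
  by_cases hy : R < 2 * ‖y‖
  · rw [indicator_of_mem (by exact hy)]
    have e : (16 / (R ^ 2) ^ 2) ^ n * (w y * (‖y‖ ^ 2) ^ (2 * n)) =
        w y * ((2 * ‖y‖) ^ 4 / R ^ 4) ^ n := by
      rw [pow_mul (‖y‖ ^ 2) 2 n, mul_left_comm, ← mul_pow]
      congr 2
      ring
    dsimp only
    rw [e]
    apply le_mul_of_one_le_right hwy
    apply one_le_pow₀
    rw [one_le_div (by positivity)]
    gcongr
  · rw [indicator_of_notMem (by exact hy)]
    positivity

end

/-! ### Choice of the moment order. -/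

/-- The elementary estimate turning moment bounds of logarithmic order into polynomial decay. -/
lemma moment_ratio_le {ρ I K t s : ℝ} (hρ : 0 ≤ ρ) (hI : 0 ≤ I) (ht : 0 ≤ t) (hs : 1 ≤ s)
    (hK : Real.exp 1 * (16 * (2 * ρ + 72 * I)) ≤ K)
    (hsK : K * ((1 + t) * Real.log (2 + t)) ≤ s ^ 2) :
    ∃ n : ℕ, s ^ 3 * (16 / s ^ 2 * (ρ + 8 * I * n * t)) ^ n ≤ (16 * (2 * ρ + 72 * I)) ^ 2 := by
  set ℓ := Real.log (2 + t) with hℓ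
  have hℓ2 : 0.69 ≤ ℓ := by
    have h1 : Real.log 2 ≤ ℓ := Real.log_le_log (by norm_num) (by linarith)
    linarith [Real.log_two_gt_d9]
  have hℓ3 : ℓ ≤ 2 + t := (Real.log_le_sub_one_of_pos (by linarith)).trans (by linarith)
  set k := ⌈4 * ℓ⌉₊ with hk
  have hk1 : 4 * ℓ ≤ k := Nat.le_ceil _
  have hk2 : (k : ℝ) < 4 * ℓ + 1 := Nat.ceil_lt_add_one (by positivity)
  -- Here $s$ plays the role of $|x|^2$. Of the $k+2$ factors, $k\ge4\ell$ are at most $e^{-1}$ and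
  -- give $(2+t)^{-4}$; the other two supply $s^{-4}$ to absorb $s^3$, at the price of $a^2\le
  -- A^2(2+t)^4$.
  refine ⟨k + 2, ?_⟩
  set A := 16 * (2 * ρ + 72 * I) with hA
  have hA0 : 0 ≤ A := by positivity
  set a := 16 * (ρ + 8 * I * (k + 2 : ℕ) * t) with ha
  have ha0 : 0 ≤ a := by positivity
  -- The constants come from $\ell\ge0.69$: then $1\le2\ell$ and $k+2\le4\ell+3\le9\ell$, whence
  -- $72=8\cdot9$.
  have haA : a ≤ A * ((1 + t) * ℓ) := by
    have h1 : ρ ≤ 2 * ρ * ((1 + t) * ℓ) := by nlinarith [mul_nonneg hρ ht]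
    have h2 : I * (k + 2 : ℕ) * t ≤ 9 * I * ((1 + t) * ℓ) := by
      push_cast
      have h3 : (k : ℝ) + 2 ≤ 9 * ℓ := by linarith
      calc I * (k + 2) * t ≤ I * (9 * ℓ) * (1 + t) := by gcongr; linarith
        _ = _ := by ring
    nlinarith
  have hs0 : 0 < s := by linarith
  have hratio : a / s ^ 2 ≤ Real.exp (-1) := by
    rw [div_le_iff₀ (by positivity)]
    have hp : 0 ≤ (1 + t) * ℓ := by positivity
    calc a ≤ A * ((1 + t) * ℓ) := haA
      _ = Real.exp (-1) * (Real.exp 1 * A * ((1 + t) * ℓ)) := by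
        rw [Real.exp_neg]; field_simp
      _ ≤ Real.exp (-1) * (K * ((1 + t) * ℓ)) := by gcongr
      _ ≤ _ := by gcongr
  have hexp : Real.exp (-1) ^ k ≤ ((2 + t) ^ 4)⁻¹ := by
    rw [← Real.exp_nat_mul]
    calc _ ≤ Real.exp (-(4 * ℓ)) := by
          rw [Real.exp_le_exp]; linarith
      _ = _ := by
          rw [Real.exp_neg, show 4 * ℓ = (4 : ℕ) * ℓ by norm_num, Real.exp_nat_mul, hℓ,
            Real.exp_log (by linarith)]
  have haT : a ^ 2 ≤ A ^ 2 * (2 + t) ^ 4 := by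
    have : a ≤ A * (2 + t) ^ 2 := by
      refine haA.trans ?_
      rw [pow_two]
      gcongr
      linarith
    calc a ^ 2 ≤ (A * (2 + t) ^ 2) ^ 2 := by gcongr
      _ = _ := by ring
  calc _ = s ^ 3 * ((a / s ^ 2) ^ 2 * (a / s ^ 2) ^ k) := by
        rw [ha, ← pow_add, add_comm 2 k]
        congr 2
        ring
    _ ≤ s ^ 3 * ((a / s ^ 2) ^ 2 * ((2 + t) ^ 4)⁻¹) := by
        gcongr
        exact (pow_le_pow_left₀ (by positivity) hratio k).trans hexp
    _ = a ^ 2 / s * ((2 + t) ^ 4)⁻¹ := by field_simp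
    _ ≤ a ^ 2 * ((2 + t) ^ 4)⁻¹ := by
        gcongr
        exact div_le_self (by positivity) hs
    _ ≤ A ^ 2 * (2 + t) ^ 4 * ((2 + t) ^ 4)⁻¹ := by gcongr
    _ = A ^ 2 := by
        have : 0 < 2 + t := by linarith
        field_simp

/-! ### Radial decay and confinement. -/

section
variable {ω₀ : Plane → ℝ}

/-- Beyond the confinement radius the radial velocity decays like the inverse cube of the
distance. -/
lemma IsEvenDatum.exists_radial_decay (h₀ : IsEvenDatum ω₀) :
    ∃ C K : ℝ, 0 ≤ C ∧ 0 ≤ K ∧ (∀ x, ω₀ x ≠ 0 → (‖x‖ ^ 2) ^ 2 ≤ K) ∧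
      ∀ (α : ℝ) (ω : ℝ → Plane → ℝ), IsExtendedSolution α ω₀ ω → ∀ t : ℝ, 0 ≤ t → ∀ x : Plane,
        1 < ‖x‖ → K * ((1 + t) * Real.log (2 + t)) ≤ (‖x‖ ^ 2) ^ 2 →
        |∫ y, radialKernel x y * ω t y| ≤ C / ‖x‖ ^ 2 := by
  obtain ⟨B, hB⟩ := h₀.contDiff.continuous.bounded_above_of_compact_support h₀.hasCompactSupport
  have hB' : ∀ x, ω₀ x ≤ B := fun x => (le_abs_self _).trans (hB x)
  have hB0 : 0 ≤ B := (norm_nonneg _).trans (hB 0)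
  obtain ⟨R, hR⟩ := h₀.hasCompactSupport.isCompact.exists_bound_of_continuousOn
    (f := fun x : Plane => (‖x‖ ^ 2) ^ 2) (by fun_prop)
  set ρ := max R 0 with hρdef
  have hρ0 : 0 ≤ ρ := le_max_right _ _
  have hρ : ∀ x, ω₀ x ≠ 0 → (‖x‖ ^ 2) ^ 2 ≤ ρ := fun x hx =>
    (le_abs_self _).trans ((hR x (subset_tsupport _ hx)).trans (le_max_left _ _))
  have hm : 0 ≤ ∫ x, ω₀ x := integral_nonneg h₀.nonneg
  have hI : 0 ≤ ∫ x, ω₀ x * ‖x‖ ^ 2 :=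
    integral_nonneg fun x => mul_nonneg (h₀.nonneg x) (sq_nonneg _)
  set m := ∫ x, ω₀ x
  set I := ∫ x, ω₀ x * ‖x‖ ^ 2
  set A := 16 * (2 * ρ + 72 * I) with hA
  -- The `+ 1` keeps the radius $\sqrt c/|x|^3$ positive even for zero mass.
  set c := m * A ^ 2 + 1 with hc
  have hc0 : 0 < c := by positivity
  -- The summand `ρ` in the threshold only serves to dominate $|x|^4$ on the initial support.
  refine ⟨4 * I + √c * (2 * Real.pi * B + 1), Real.exp 1 * A + ρ, by positivity, by positivity,
    fun x hx => (hρ x hx).trans (by linarith [show 0 ≤ Real.exp 1 * A by positivity]), ?_⟩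
  intro α ω h t ht x hx hxt
  have hx0 : 0 < ‖x‖ := by linarith
  have hs1 : 1 ≤ ‖x‖ ^ 2 := one_le_pow₀ hx.le
  obtain ⟨n, hn⟩ := moment_ratio_le hρ0 hI ht hs1
    (le_add_of_nonneg_right hρ0 : Real.exp 1 * A ≤ Real.exp 1 * A + ρ) hxt
  have hw := h.isBoundedVorticity h₀ hB' ht
  have hpos := h.nonneg h₀ ht
  obtain ⟨a, b, ha, hab⟩ := h.exists_closedAnnulus h₀.hasCompactSupport h₀.tsupport_subset t
  have hab' := hab t ⟨ht, le_rfl⟩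
  have htail : ∫ y, {y : Plane | ‖x‖ < 2 * ‖y‖}.indicator (ω t) y ≤ (√c / ‖x‖ ^ 3) ^ 2 := by
    have h1 := hw.integral_tail_le hab' hpos hx0 n
    have h2 := h.moment_le h₀ hρ0 hρ n ht
    have h3 : (√c / ‖x‖ ^ 3) ^ 2 = c / (‖x‖ ^ 2) ^ 3 := by
      rw [div_pow, Real.sq_sqrt hc0.le]; congr 1; ring
    rw [h3, le_div_iff₀ (by positivity)]
    calc _ ≤ ((16 / (‖x‖ ^ 2) ^ 2) ^ n * (m * (ρ + 8 * I * n * t) ^ n)) * (‖x‖ ^ 2) ^ 3 := by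
          gcongr
          exact h1.trans (by gcongr)
      _ = m * ((‖x‖ ^ 2) ^ 3 * (16 / (‖x‖ ^ 2) ^ 2 * (ρ + 8 * I * n * t)) ^ n) := by
          rw [mul_pow]; ring
      _ ≤ m * A ^ 2 := by gcongr
      _ ≤ c := by linarith
  have hmoment : Integrable fun y => ω t y * ‖y‖ ^ 2 := by
    simpa using hw.integrable_mul_norm_pow hab' 1
  have key := hw.abs_integral_radialKernel_far_le hpos (h.even h₀ ht) hmoment hx
    (by positivity : 0 < √c / ‖x‖ ^ 3) htail
  rw [h.integral_mul_norm_sq h₀ ht] at key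
  refine key.trans (le_of_eq ?_)
  field_simp
  rfl

lemma log_two_add_ge_half {t : ℝ} (ht : 0 ≤ t) : 1 / 2 ≤ Real.log (2 + t) := by
  have h1 : Real.log 2 ≤ Real.log (2 + t) := Real.log_le_log (by norm_num) (by linarith)
  linarith [Real.log_two_gt_d9]

/-- Confinement: the vorticity vanishes outside a ball whose radius to the fourth power is
`O((1 + t) log (2 + t))`. -/
lemma IsEvenDatum.exists_confinement (h₀ : IsEvenDatum ω₀) :
    ∃ K : ℝ, 0 < K ∧ ∀ (α : ℝ) (ω : ℝ → Plane → ℝ), IsExtendedSolution α ω₀ ω →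
      ∀ t : ℝ, 0 ≤ t → ∀ x, ω t x ≠ 0 → (‖x‖ ^ 2) ^ 2 ≤ K * ((1 + t) * Real.log (2 + t)) := by
  obtain ⟨C, K, hC, hK, hinit, hdecay⟩ := h₀.exists_radial_decay
  -- Since $\log(2+s)\ge1/2$, the term `2 * K` places the initial support below the barrier and
  -- keeps the region above it within the range of the decay estimate, while `8 * C` makes the
  -- barrier rise at rate at least $4C$.
  set μ := 2 * K + 8 * C + 1 with hμ
  have hμ0 : 0 < μ := by positivity
  refine ⟨μ, hμ0, fun α ω h t ht x hne => ?_⟩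
  by_contra hlt
  rw [not_le] at hlt
  obtain ⟨a, b, ha, hab⟩ := h.exists_closedAnnulus h₀.hasCompactSupport h₀.tsupport_subset t
  have hZ : ∀ s : ℝ, 0 ≤ s → HasDerivAt (fun s => μ * ((1 + s) * Real.log (2 + s)))
      (μ * (Real.log (2 + s) + (1 + s) / (2 + s))) s := by
    intro s hs
    have h1 : HasDerivAt (fun s : ℝ => 1 + s) 1 s := (hasDerivAt_id s).const_add 1
    have h2 : HasDerivAt (fun s : ℝ => Real.log (2 + s)) (1 / (2 + s)) s :=
      ((hasDerivAt_id s).const_add 2).log (by simp only [id]; linarith)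
    exact ((h1.mul h2).const_mul μ).congr_deriv (by ring)
  refine hne (h.eq_zero_of_barrier
    (ζ := fun s y => (‖y‖ ^ 2) ^ 2 - μ * ((1 + s) * Real.log (2 + s))) ?_
    (isCompact_closedAnnulus a b) (closedAnnulus_subset ha) (fun s hs y hy => Or.inl (hab s hs y hy))
    (fun y hy hy0 => ?_) (fun s hs y hy hyζ => ?_) ⟨ht, le_rfl⟩ (sub_pos.2 hlt))
  · have h1 : ContDiff ℝ 1 fun p : ℝ × Plane => (‖p.2‖ ^ 2) ^ 2 :=
      ((contDiff_norm_sq ℝ).comp contDiff_snd).pow _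
    refine h1.contDiffOn.sub (contDiffOn_const.mul (ContDiffOn.mul (by fun_prop)
      (ContDiffOn.log (by fun_prop) fun p hp => ?_)))
    have : 0 ≤ p.1 := hp.1
    positivity
  · have h1 := hinit y hy0
    have h2 := log_two_add_ge_half (le_refl (0 : ℝ))
    have h3 : μ * (1 / 2) ≤ μ * ((1 + 0) * Real.log (2 + 0)) := by
      gcongr; linarith
    exact sub_nonpos.2 (h1.trans (le_trans (by linarith) h3))
  · have hs0 := hs.1.le
    have hlog := log_two_add_ge_half hs0
    have e1 : deriv (fun s => (‖y‖ ^ 2) ^ 2 - μ * ((1 + s) * Real.log (2 + s))) s =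
        -(μ * (Real.log (2 + s) + (1 + s) / (2 + s))) := ((hZ s hs0).const_sub _).deriv
    have e2 : fderiv ℝ (fun y : Plane => (‖y‖ ^ 2) ^ 2 - μ * ((1 + s) * Real.log (2 + s))) y =
        (2 * ‖y‖ ^ 2) • (2 • (innerSL ℝ y)) := by
      simpa using (((hasFDerivAt_norm_sq y).pow 2).sub_const
        (μ * ((1 + s) * Real.log (2 + s)))).fderiv
    obtain ⟨A, B, hAB⟩ := h.exists_bound s
    have hw := hAB s ⟨hs0, le_rfl⟩
    rw [e1, e2]
    simp only [smul_apply, innerSL_apply_apply, hw.inner_velocity α hy, smul_eq_mul, nsmul_eq_mul]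
    have hfar : K * ((1 + s) * Real.log (2 + s)) ≤ (‖y‖ ^ 2) ^ 2 := by
      have : K * ((1 + s) * Real.log (2 + s)) ≤ μ * ((1 + s) * Real.log (2 + s)) := by
        gcongr; linarith
      linarith
    have hd := (le_abs_self _).trans (hdecay α ω h s hs0 y hy hfar)
    set J := ∫ z, radialKernel y z * ω s z
    have hy2 : 0 < ‖y‖ ^ 2 := by linarith [norm_sq_sub_one_pos hy]
    rw [le_div_iff₀ hy2] at hd
    have hπ : (2 * Real.pi)⁻¹ ≤ 1 := inv_le_one_of_one_le₀ (by linarith [Real.pi_gt_three])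
    -- This is the material derivative of $|y|^4$, namely $4|y|^2\,y\cdot u$; the $|y|^{-2}$ decay
    -- of $y\cdot u$ makes it bounded, which accounts for the exponent $1/4$.
    have h1 : 2 * ‖y‖ ^ 2 * ((2 : ℕ) * ((2 * Real.pi)⁻¹ * J)) ≤ 4 * C := by
      calc _ = 4 * ((2 * Real.pi)⁻¹ * (J * ‖y‖ ^ 2)) := by push_cast; ring
        _ ≤ 4 * (1 * C) := by
          have : (2 * Real.pi)⁻¹ * (J * ‖y‖ ^ 2) ≤ (2 * Real.pi)⁻¹ * C := by gcongr
          have : (2 * Real.pi)⁻¹ * C ≤ 1 * C := by gcongr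
          linarith
        _ = _ := by ring
    have h2 : μ * (1 / 2) ≤ μ * (Real.log (2 + s) + (1 + s) / (2 + s)) := by
      have : 0 ≤ (1 + s) / (2 + s) := by positivity
      gcongr; linarith
    linarith

end

theorem theorem14 (ω₀ : Plane → ℝ) (hsmooth : ContDiff ℝ 1 ω₀)
    (hcompact : HasCompactSupport ω₀) (hsupp : tsupport ω₀ ⊆ exteriorDisk)
    (hnonneg : ∀ x, 0 ≤ ω₀ x) (heven : ∀ x, ω₀ (-x) = ω₀ x) :
    ∃ M : ℝ, 0 < M ∧ ∀ (α : ℝ) (ω : ℝ → Plane → ℝ), IsExteriorEulerSolution α ω₀ ω →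
      ∀ t : ℝ, 0 ≤ t →
        vorticitySupport (ω t) ⊆
          {x | ‖x‖ ≤ M * ((1 + t) * Real.log (2 + t)) ^ (1 / 4 : ℝ)} := by
  have h₀ : IsEvenDatum ω₀ := ⟨hsmooth, hcompact, hsupp, hnonneg, heven⟩
  obtain ⟨K, hK, hconf⟩ := h₀.exists_confinement
  refine ⟨K ^ (1 / 4 : ℝ), Real.rpow_pos_of_pos hK _, fun α ω h t ht => ?_⟩
  have hlog := log_two_add_ge_half ht
  have hL : 0 ≤ (1 + t) * Real.log (2 + t) := by positivity
  refine closure_minimal (fun x hx => ?_) (isClosed_le continuous_norm continuous_const)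
  have h1 := hconf α _ h.extend t ht x (by rw [indicator_of_mem hx.1]; exact hx.2)
  rw [mem_ofPred_eq, ← Real.mul_rpow hK.le hL]
  have h2 : ‖x‖ = ((‖x‖ ^ 2) ^ 2) ^ (1 / 4 : ℝ) := by
    rw [← pow_mul, ← Real.rpow_natCast, ← Real.rpow_mul (norm_nonneg x)]
    norm_num
  rw [h2]
  exact Real.rpow_le_rpow (by positivity) h1 (by norm_num)
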